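/- **Setting.** Let $A$ be a Noetherian ring, separated and complete for the $I$-adic topology of an ideal $I$. Let $\mathcal A_{m,n}=A\langle X_1,\dots,X_m\rangle[[Y_1,\dots,Y_n]]$ be the ring of power series $\sum_{\mu,\nu}a_{\mu,\nu}X^\mu Y^\nu$ over $A$ such that for each fixed $\nu$ the $a_{\mu,\nu}$ tend $I$-adically to $0$, and let $t\mapsto t^\sigma$ be an automorphism of the inductive system of rings $(\mathcal A_{m,n})$. For a valued field $K$ with valuation ring $\mathcal O$ and maximal ideal $\mathfrak M$, put $RV_n=K^*/(1+n\mathfrak M)\cup\{0\}$ ($n\ge 1$), with canonical map $rv_n:K\to RV_n$. The language has sorts $K$ and $RV_n$ ($n\geq 1$); the ring language on $K$; $rv_n:K\to RV_n$ and the projections $RV_n\to RV_m$ ($m\mid n$); on $RV_n$ the constants $0,1$, the multiplication, and a relation $x\mid y$; maps $+_{m,n}:RV_n^2\to RV_m$ ($m\mid n$); a relation $\mid'$ on $RV_1$; $Q:K^2\to K$; a symbol $K^{m+n}\to K$ for each $f\in\mathcal A_{m,n}$; a symbol $E_k:RV_k^{m+n}\to RV_k$ for each unit $E$ of $\mathcal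 A_{m,n}$ and each $k\ge1$; symbols $\sigma:K\to K$ and $\sigma_n:RV_n\to RV_n$. A structure is an *analytic field with an automorphism* if: * it comes from a valued field $(K,\mathcal O)$ of characteristic $0$ with $RV_n$, $rv_n$, the projections and the multiplications as above; $rv_n(x)\mid rv_n(y)$ means $v(x)\le v(y)$; $rv_n(x)+_{m,n}rv_n(y)$ is $rv_m(x+y)$ if $v(x+y)\le\min\{v(x),v(y)\}+v(n)-v(m)$, and $0$ otherwise; $Q(x,y)=x/y$ if $y\ne0$ and $Q(x,0)=0$; * there is a valuation ring $\mathcal O'\subseteq\mathcal O$ of $K$, with maximal ideal $\mathfrak M'$ and valuation $v'$, such that $rv_1(x)\mid' rv_1(y)$ means $v'(x)\le v'(y)$; each $f\in\mathcal A_{m,n}$ maps $\mathcal O'^m\times\mathfrak M'^n$ to $\mathcal O'$ and is $0$ elsewhere; these interpretations are ring morphisms from $\mathcal A_{m,n}$ to the $\mathcal O'$-valued functions on $\mathcal O'^m\times\mathfrak M'^n$, compatible with the inclusions of the inductive systems; elements of $I$ are sent into $\mathfrak M'$; $X_i$ and $Y_j$ are sent to the coordinate functions; and $E_k$ is the function induced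 by $E$ on $RV_k$; * $\sigma$ is a field automorphism of $K$, the $\sigma_n$ are bijections that it induces on $RV_n$ (compatibly with the projections), $\mid'$ is preserved by $\sigma_1$, and $\sigma(f(x))=f^\sigma(\sigma(x))$ for all $f\in\mathcal A_{m,n}$ and $x\in K^{m+n}$. Write $\nabla(x)=(x,\sigma(x),\dots,\sigma^N(x))$. Let $t$ be a term of sort $K$ in $N+1$ variables, built from the ring operations, $Q$, the symbols of the $\mathcal A_{m,n}$ and parameters from $K$; let $a\in K$, $d\in K^{N+1}$, $\xi\in v(K^*)$ and $b=\{x: v(x-a)>\xi\}$. Then $(t,a,d,\xi)$ is in *$\sigma$-Hensel configuration* if $d$ linearly approximates $t$ at prolongations on $b$, that is $$v\bigl(t(\nabla(y))-t(\nabla(x))-d\cdot\nabla(y-x)\bigr)>\min_i\{v(d_i)+v(\sigma^i(y-x))\}\quad\text{for all } x\neq y \text{ in } b$$ (or $d=0$ and $t\circ\nabla$ is constant on $b$), and $v(t(\nabla(a)))>\min_i\{v(d_i)+\sigma^i(\xi)\}$, where $\sigma$ denotes also the induced automorphism of the value group. The structure is *$\sigma$-Henselian* if for each such configuration there is $c\in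 K$ with $t(\nabla(c))=0$ and $v(c-a)\ge\max_{i:\,d_i\ne0}v\bigl(\sigma^{-i}(t(\nabla(a))d_i^{-1})\bigr)$. The models of $\mathrm{TA}^{H}_{\sigma}[0,p]$ are the $\sigma$-Henselian analytic fields with an automorphism for which $v$ is nontrivial and the residue field of $\mathcal O$ has characteristic $p$. **Proposition.** Let $p$ be a prime, let $W=W(\overline{\mathbb F}_p)$ be the ring of Witt vectors of an algebraic closure of $\mathbb F_p$, and let $K=\mathrm{Frac}(W)$, with valuation ring $\mathcal O=\mathcal O'=W$. Take $(A,I)=(W,pW)$ and interpret $f=\sum a_{\mu,\nu}X^\mu Y^\nu\in W\langle X\rangle[[Y]]$ on $W^m\times(pW)^n$ by the $p$-adically convergent sum $\sum a_{\mu,\nu}x^\mu y^\nu$ and by $0$ elsewhere; let $\sigma$ be the automorphism of $K$ that lifts the Frobenius automorphism of $\overline{\mathbb F}_p$, and let $f^\sigma$ be obtained from $f$ by applying $\sigma$ to the coefficients. The resulting structure is a model of $\mathrm{TA}^{H}_{\sigma}[0,p]$. -/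

import Mathlib

noncomputable section

namespace AnalyticDifference

universe u v

/-! ### The rings of separated power series -/

section Series

variable (A : Type u) [CommRing A] (I : Ideal A)

variable {A} in
theorem finite_coeff_mul {m n : ℕ} (f g : MvPowerSeries (Fin m ⊕ Fin n) A)
    (hf : ∀ (ν : Fin n →₀ ℕ) (k : ℕ),
      {μ : Fin m →₀ ℕ | MvPowerSeries.coeff (Finsupp.sumElim μ ν) f ∉ I ^ k}.Finite)
    (hg : ∀ (ν : Fin n →₀ ℕ) (k : ℕ),
      {μ : Fin m →₀ ℕ | MvPowerSeries.coeff (Finsupp.sumElim μ ν) g ∉ I ^ k}.Finite)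
    (ν : Fin n →₀ ℕ) (k : ℕ) :
    {μ : Fin m →₀ ℕ | MvPowerSeries.coeff (Finsupp.sumElim μ ν) (f * g) ∉ I ^ k}.Finite := by
  classical
  let S : (Fin n →₀ ℕ) × (Fin n →₀ ℕ) → Set (Fin m →₀ ℕ) := fun q =>
    Set.image2 (fun a b => a + b)
      {μ : Fin m →₀ ℕ | MvPowerSeries.coeff (Finsupp.sumElim μ q.1) f ∉ I ^ k}
      {μ : Fin m →₀ ℕ | MvPowerSeries.coeff (Finsupp.sumElim μ q.2) g ∉ I ^ k}
  have hS : (⋃ q ∈ (Finset.HasAntidiagonal.antidiagonal ν : Finset _), S q).Finite :=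
    Set.Finite.biUnion (Finset.finite_toSet _) fun q _ => (hf q.1 k).image2 _ (hg q.2 k)
  refine hS.subset ?_
  intro μ hμ
  by_contra h
  apply hμ
  rw [MvPowerSeries.coeff_mul]
  refine sum_mem fun r hr => ?_
  have hr' : r.1 + r.2 = Finsupp.sumElim μ ν := by
    simpa only [Finset.HasAntidiagonal.mem_antidiagonal] using hr
  let part1 : (Fin m ⊕ Fin n →₀ ℕ) → (Fin m →₀ ℕ) :=
    fun e => e.comapDomain Sum.inl Sum.inl_injective.injOn
  let part2 : (Fin m ⊕ Fin n →₀ ℕ) → (Fin n →₀ ℕ) :=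
    fun e => e.comapDomain Sum.inr Sum.inr_injective.injOn
  have hp : ∀ e, Finsupp.sumElim (part1 e) (part2 e) = e := by
    intro e
    ext i
    cases i <;> rfl
  by_contra hn
  apply h
  simp only [Set.mem_iUnion]
  refine ⟨(part2 r.1, part2 r.2), ?_, part1 r.1, ?_, part1 r.2, ?_, ?_⟩
  · rw [Finset.HasAntidiagonal.mem_antidiagonal]
    ext j
    exact DFunLike.congr_fun hr' (Sum.inr j)
  · intro hc
    apply hn
    rw [hp] at hc
    exact Ideal.mul_mem_right _ _ hc
  · intro hc
    apply hn
    rw [hp] at hc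
    exact Ideal.mul_mem_left _ _ hc
  · ext j
    exact DFunLike.congr_fun hr' (Sum.inl j)

/-- `Ann A I m n` is the ring `A⟨X₁, …, Xₘ⟩[[Y₁, …, Yₙ]]`, as a subring of `A[[X, Y]]`: the power
series `∑ a_{μ,ν} X^μ Y^ν` such that for each fixed `ν` the coefficients `a_{μ,ν}` converge to `0`
for the `I`-adic topology (as `μ` leaves finite sets). -/
def Ann (m n : ℕ) : Subring (MvPowerSeries (Fin m ⊕ Fin n) A) where
  carrier := {f | ∀ (ν : Fin n →₀ ℕ) (k : ℕ),
    {μ : Fin m →₀ ℕ | MvPowerSeries.coeff (Finsupp.sumElim μ ν) f ∉ I ^ k}.Finite}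
  zero_mem' := fun ν k => by simp
  one_mem' := fun ν k => by
    classical
    refine (Set.finite_singleton (0 : Fin m →₀ ℕ)).subset ?_
    intro μ hμ
    by_contra h
    apply hμ
    rw [MvPowerSeries.coeff_one, if_neg]
    · exact zero_mem _
    · intro h0
      apply h
      ext i
      simpa using DFunLike.congr_fun h0 (Sum.inl i)
  add_mem' := fun {f g} hf hg ν k => by
    refine ((hf ν k).union (hg ν k)).subset ?_
    intro μ hμ
    by_contra h
    simp only [Set.mem_union, Set.mem_ofPred_eq, not_or, not_not] at h
    exact hμ (by rw [map_add]; exact add_mem h.1 h.2)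
  neg_mem' := fun {f} hf ν k => by
    refine (hf ν k).subset ?_
    intro μ hμ h
    exact hμ (by rw [map_neg]; exact neg_mem h)
  mul_mem' := fun {f g} hf hg => finite_coeff_mul I f g hf hg

/-- The inclusion of variables `X_i ↦ X_i`, `Y_j ↦ Y_j`. -/
def varEmb {m n m' n' : ℕ} (hm : m ≤ m') (hn : n ≤ n') : Fin m ⊕ Fin n ↪ Fin m' ⊕ Fin n' :=
  (Fin.castLEEmb hm).sumMap (Fin.castLEEmb hn)

/-- The transition maps `Ann m n → Ann m' n'` of the inductive system. -/
def Ann.incl {m n m' n' : ℕ} (hm : m ≤ m') (hn : n ≤ n') : Ann A I m n →+* Ann A I m' n' :=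
  RingHom.codRestrict
    (((MvPowerSeries.rename (R := A) (varEmb hm hn)).toRingHom).comp (Ann A I m n).subtype)
    (Ann A I m' n') (by
      rintro ⟨f, hf⟩ ν' k
      let ν : Fin n →₀ ℕ := ν'.comapDomain (Fin.castLE hn) (Fin.castLE_injective hn).injOn
      refine ((hf ν k).image (Finsupp.embDomain (Fin.castLEEmb hm))).subset ?_
      intro μ' hμ'
      by_cases hr : Finsupp.sumElim μ' ν' ∈
          Set.range (Finsupp.mapDomain (varEmb hm hn) : (_ →₀ ℕ) → _)
      · obtain ⟨x, hx⟩ := hr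
        rw [← Finsupp.embDomain_eq_mapDomain] at hx
        have h1 : ∀ i, x (Sum.inl i) = μ' (Fin.castLE hm i) := fun i => by
          have := DFunLike.congr_fun hx (varEmb hm hn (Sum.inl i))
          rw [Finsupp.embDomain_apply_self] at this
          simpa [varEmb] using this
        have h2 : ∀ j, x (Sum.inr j) = ν' (Fin.castLE hn j) := fun j => by
          have := DFunLike.congr_fun hx (varEmb hm hn (Sum.inr j))
          rw [Finsupp.embDomain_apply_self] at this
          simpa [varEmb] using this
        let μ : Fin m →₀ ℕ := μ'.comapDomain (Fin.castLE hm) (Fin.castLE_injective hm).injOn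
        have hxe : x = Finsupp.sumElim μ ν := by
          ext i
          cases i <;> simp [h1, h2, μ, ν]
        refine ⟨μ, ?_, ?_⟩
        · intro hc
          apply hμ'
          change MvPowerSeries.coeff _ (MvPowerSeries.rename (varEmb hm hn) f) ∈ _
          rw [← hx, MvPowerSeries.coeff_embDomain_rename, hxe]
          exact hc
        · ext i
          by_cases hi : i ∈ Set.range (Fin.castLEEmb hm)
          · obtain ⟨i, rfl⟩ := hi
            rw [Finsupp.embDomain_apply_self]
            simp [μ]
          · rw [Finsupp.embDomain_of_notMem_range _ _ _ hi]
            have := DFunLike.congr_fun hx (Sum.inl i)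
            rw [Finsupp.embDomain_of_notMem_range] at this
            · simpa using this
            · rintro ⟨a, ha⟩
              cases a with
              | inl a => exact hi ⟨a, by simpa [varEmb] using ha⟩
              | inr a => simp [varEmb] at ha
      · exact absurd (by
          change MvPowerSeries.coeff _ (MvPowerSeries.rename (varEmb hm hn) f) ∈ _
          rw [MvPowerSeries.coeff_rename_eq_zero _ _ hr]
          exact zero_mem _) hμ')

/-- The variable `X_i` of `Ann m n`. -/
def Ann.X {m n : ℕ} (i : Fin m) : Ann A I m n :=
  ⟨MvPowerSeries.X (Sum.inl i), fun ν k => by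
    classical
    refine (Set.finite_singleton (Finsupp.single i 1)).subset ?_
    intro μ hμ
    by_contra h
    apply hμ
    rw [MvPowerSeries.coeff_X, if_neg]
    · exact zero_mem _
    · intro h0
      apply h
      ext j
      simpa [Finsupp.single_apply] using DFunLike.congr_fun h0 (Sum.inl j)⟩

/-- The variable `Y_j` of `Ann m n`. -/
def Ann.Y {m n : ℕ} (j : Fin n) : Ann A I m n :=
  ⟨MvPowerSeries.X (Sum.inr j), fun ν k => by
    classical
    refine (Set.finite_singleton (0 : Fin m →₀ ℕ)).subset ?_
    intro μ hμ
    by_contra h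
    apply hμ
    rw [MvPowerSeries.coeff_X, if_neg]
    · exact zero_mem _
    · intro h0
      apply h
      ext i
      simpa [Finsupp.single_apply] using DFunLike.congr_fun h0 (Sum.inl i)⟩

/-- The constant `a ∈ A = Ann 0 0`. -/
def Ann.const (a : A) : Ann A I 0 0 :=
  ⟨MvPowerSeries.C a, fun _ _ => Set.toFinite _⟩

/-- An automorphism of the inductive system of rings `(Ann m n)`. -/
structure AnnAut where
  toEquiv : ∀ m n, Ann A I m n ≃+* Ann A I m n
  compat : ∀ {m n m' n' : ℕ} (hm : m ≤ m') (hn : n ≤ n') (f : Ann A I m n),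
    toEquiv m' n' (Ann.incl A I hm hn f) = Ann.incl A I hm hn (toEquiv m n f)

variable {A I} in
theorem map_mem_pow_iff (φ : A ≃+* A) (hφ : I.map (φ : A →+* A) = I) (k : ℕ) (a : A) :
    φ a ∈ I ^ k ↔ a ∈ I ^ k := by
  have h : (I ^ k).map (φ : A →+* A) = I ^ k := by rw [Ideal.map_pow, hφ]
  constructor
  · intro ha
    rw [← h] at ha
    obtain ⟨b, hb, hba⟩ := (Ideal.mem_map_iff_of_surjective (φ : A →+* A) φ.surjective).1 ha
    rwa [← φ.injective hba]
  · intro ha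
    have := Ideal.mem_map_of_mem (φ : A →+* A) ha
    rwa [h] at this

variable {A I} in
/-- The automorphism of the system `(Ann m n)` that applies `φ` to every coefficient. -/
def AnnAut.ofRingEquiv (φ : A ≃+* A) (hφ : I.map (φ : A →+* A) = I) : AnnAut A I where
  toEquiv m n :=
    { toFun := fun f => ⟨MvPowerSeries.map (φ : A →+* A) f.1, fun ν k => by
        simpa [map_mem_pow_iff φ hφ] using f.2 ν k⟩
      invFun := fun f => ⟨MvPowerSeries.map (φ.symm : A →+* A) f.1, fun ν k => by
        have h : ∀ a, φ.symm a ∈ I ^ k ↔ a ∈ I ^ k := fun a => by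
          rw [← map_mem_pow_iff φ hφ, φ.apply_symm_apply]
        simpa [h] using f.2 ν k⟩
      left_inv := fun f => by ext; simp
      right_inv := fun f => by ext; simp
      map_mul' := fun f g => Subtype.ext (map_mul _ _ _)
      map_add' := fun f g => Subtype.ext (map_add _ _ _) }
  compat hm hn f := by
    apply Subtype.ext
    ext e
    change MvPowerSeries.coeff e
        (MvPowerSeries.map (φ : A →+* A) (MvPowerSeries.rename (varEmb hm hn) f.1)) =
      MvPowerSeries.coeff e
        (MvPowerSeries.rename (varEmb hm hn) (MvPowerSeries.map (φ : A →+* A) f.1))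
    rw [MvPowerSeries.coeff_map]
    by_cases hr : e ∈ Set.range (Finsupp.mapDomain (varEmb hm hn) : (_ →₀ ℕ) → _)
    · obtain ⟨x, rfl⟩ := hr
      rw [← Finsupp.embDomain_eq_mapDomain, MvPowerSeries.coeff_embDomain_rename,
        MvPowerSeries.coeff_embDomain_rename, MvPowerSeries.coeff_map]
    · rw [MvPowerSeries.coeff_rename_eq_zero _ _ hr, MvPowerSeries.coeff_rename_eq_zero _ _ hr,
        map_zero]

end Series
/-! ### Structures and models -/

section Models

/-- Structures in the language of fields with separated analytic structure and an automorphism: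
the sorts are `K` and the `RV n`, `n > 0`, and there is one field for each symbol. -/
structure Struc (A : Type u) [CommRing A] (I : Ideal A) : Type (max u (v + 1)) where
  /-- the field sort -/
  K : Type v
  /-- the leading term sorts -/
  RV : ℕ+ → Type v
  zero : K
  one : K
  add : K → K → K
  neg : K → K
  mul : K → K → K
  /-- the quotient symbol `Q` -/
  quot : K → K → K
  /-- the leading term maps -/
  rv : ∀ n, K → RV n
  /-- the transition maps between the leading term sorts -/
  rvMap : ∀ m n, m ∣ n → RV n → RV m
  rvZero : ∀ n, RV n
  rvOne : ∀ n, RV n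
  rvMul : ∀ n, RV n → RV n → RV n
  /-- comparison of valuations, `val x ≤ val y` -/
  rvDiv : ∀ n, RV n → RV n → Prop
  /-- the partial additions `+_{m,n}` -/
  rvAdd : ∀ m n, m ∣ n → RV n → RV n → RV m
  /-- comparison on `RV 1` for the finer valuation -/
  rvDivR : RV 1 → RV 1 → Prop
  /-- the symbols of the separated power series -/
  ann : ∀ {m n : ℕ}, Ann A I m n → (Fin m → K) → (Fin n → K) → K
  /-- the traces on `RV k` of the units of the rings of separated power series -/
  unitRV : ∀ {m n : ℕ} (k : ℕ+), (Ann A I m n)ˣ → (Fin m → RV k) → (Fin n → RV k) → RV k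
  /-- the symbol `σ` on the field sort -/
  sig : K → K
  /-- the symbols `σ_n` on the leading term sorts -/
  sigRV : ∀ n, RV n → RV n

variable {A : Type u} [CommRing A] {I : Ideal A}

/-- Terms of sort `K`, without `σ`, in the variables `x_0, …, x_{N-1}` and with parameters in `P`.
(No symbol leads from a leading term sort to the field sort.) -/
inductive KTerm (A : Type u) [CommRing A] (I : Ideal A) (P : Type v) (N : ℕ) : Type (max u v)
  | var : Fin N → KTerm A I P N
  | param : P → KTerm A I P N
  | zero : KTerm A I P N
  | one : KTerm A I P N
  | add : KTerm A I P N → KTerm A I P N → KTerm A I P N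
  | neg : KTerm A I P N → KTerm A I P N
  | mul : KTerm A I P N → KTerm A I P N → KTerm A I P N
  | quot : KTerm A I P N → KTerm A I P N → KTerm A I P N
  | ann {m n : ℕ} (f : Ann A I m n) (x : Fin m → KTerm A I P N) (y : Fin n → KTerm A I P N) :
      KTerm A I P N

/-- The interpretation of a term. -/
def KTerm.eval (M : Struc.{u, v} A I) {N : ℕ} (a : Fin N → M.K) : KTerm A I M.K N → M.K
  | .var i => a i
  | .param c => c
  | .zero => M.zero
  | .one => M.one
  | .add s t => M.add (s.eval M a) (t.eval M a)
  | .neg s => M.neg (s.eval M a)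
  | .mul s t => M.mul (s.eval M a) (t.eval M a)
  | .quot s t => M.quot (s.eval M a) (t.eval M a)
  | .ann f x y => M.ann f (fun i => (x i).eval M a) (fun j => (y j).eval M a)

/-- `M` is the structure of a valued field of characteristic zero, with valuation ring `O`: the ring
symbols are those of the field, `RV n` is `Kˣ / (1 + n 𝔪) ∪ {0}`, and the symbols on the leading
term sorts have their standard interpretation. (The valuations of Mathlib are multiplicative:
`val x ≤ val y` means `O.valuation y ≤ O.valuation x`.) -/
structure IsValuedField (M : Struc.{u, v} A I) [Field M.K] (O : ValuationSubring M.K) : Prop where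
  zero_eq : M.zero = 0
  one_eq : M.one = 1
  add_eq : ∀ x y, M.add x y = x + y
  neg_eq : ∀ x, M.neg x = -x
  mul_eq : ∀ x y, M.mul x y = x * y
  charZero : CharZero M.K
  rv_surjective : ∀ n : ℕ+, Function.Surjective (M.rv n)
  rv_eq_iff : ∀ (n : ℕ+) (x y : M.K), M.rv n x = M.rv n y ↔
    (x = 0 ∧ y = 0) ∨
      (x ≠ 0 ∧ y ≠ 0 ∧ ∃ μ, O.valuation μ < 1 ∧ x = y * (1 + ((n : ℕ) : M.K) * μ))
  rvMap_rv : ∀ m n (h : m ∣ n) x, M.rvMap m n h (M.rv n x) = M.rv m x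
  rvZero_eq : ∀ n, M.rvZero n = M.rv n 0
  rvOne_eq : ∀ n, M.rvOne n = M.rv n 1
  rvMul_rv : ∀ n x y, M.rvMul n (M.rv n x) (M.rv n y) = M.rv n (x * y)
  rvDiv_rv : ∀ n x y, M.rvDiv n (M.rv n x) (M.rv n y) ↔ O.valuation y ≤ O.valuation x
  rvAdd_rv : ∀ (m n : ℕ+) (h : m ∣ n) x y,
    O.valuation ((n : ℕ) * x) ≤ O.valuation ((m : ℕ) * (x + y)) →
    O.valuation ((n : ℕ) * y) ≤ O.valuation ((m : ℕ) * (x + y)) →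
      M.rvAdd m n h (M.rv n x) (M.rv n y) = M.rv m (x + y)
  rvAdd_rv_of_not : ∀ (m n : ℕ+) (h : m ∣ n) x y,
    ¬ (O.valuation ((n : ℕ) * x) ≤ O.valuation ((m : ℕ) * (x + y)) ∧
        O.valuation ((n : ℕ) * y) ≤ O.valuation ((m : ℕ) * (x + y))) →
      M.rvAdd m n h (M.rv n x) (M.rv n y) = M.rvZero m

/-- The set `Rᵐ × 𝔪_Rⁿ` on which the separated power series live. -/
def InDomain {K : Type v} [Field K] (R : ValuationSubring K) {m n : ℕ}
    (x : Fin m → K) (y : Fin n → K) : Prop :=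
  (∀ i, x i ∈ R) ∧ ∀ j, R.valuation (y j) < 1

/-- The axioms of a field with separated analytic structure, for the valuation ring `O` and the
valuation subring `R ⊆ O` over which the analytic structure lives. -/
structure IsAnalyticField (M : Struc.{u, v} A I) [Field M.K] (O R : ValuationSubring M.K) :
    Prop extends IsValuedField M O where
  quot_eq : ∀ x y, y ≠ 0 → M.quot x y = x / y
  quot_zero : ∀ x, M.quot x 0 = 0
  le : R ≤ O
  rvDivR_rv : ∀ x y, M.rvDivR (M.rv 1 x) (M.rv 1 y) ↔ R.valuation y ≤ R.valuation x
  ann_mem : ∀ {m n} (f : Ann A I m n) x y, InDomain R x y → M.ann f x y ∈ R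
  ann_of_not : ∀ {m n} (f : Ann A I m n) x y, ¬ InDomain R x y → M.ann f x y = 0
  ann_one : ∀ {m n} x y, InDomain R x y → M.ann (1 : Ann A I m n) x y = 1
  ann_add : ∀ {m n} (f g : Ann A I m n) x y, InDomain R x y →
    M.ann (f + g) x y = M.ann f x y + M.ann g x y
  ann_mul : ∀ {m n} (f g : Ann A I m n) x y, InDomain R x y →
    M.ann (f * g) x y = M.ann f x y * M.ann g x y
  ann_incl : ∀ {m n m' n'} (hm : m ≤ m') (hn : n ≤ n') (f : Ann A I m n) x y, InDomain R x y →
    M.ann (Ann.incl A I hm hn f) x y =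
      M.ann f (fun i => x (Fin.castLE hm i)) (fun j => y (Fin.castLE hn j))
  ann_const : ∀ a ∈ I, ∀ x y, R.valuation (M.ann (Ann.const A I a) x y) < 1
  ann_X : ∀ {m n} (i : Fin m) x (y : Fin n → M.K), InDomain R x y → M.ann (Ann.X A I i) x y = x i
  ann_Y : ∀ {m n} (j : Fin n) (x : Fin m → M.K) y, InDomain R x y → M.ann (Ann.Y A I j) x y = y j
  unitRV_rv : ∀ {m n} (k : ℕ+) (E : (Ann A I m n)ˣ) x y,
    M.unitRV k E (fun i => M.rv k (x i)) (fun j => M.rv k (y j)) = M.rv k (M.ann E.1 x y)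

/-- `σ`, with the `σ_n`, is an automorphism of the leading term structure and of the finer
valuation, it is `s` on the field, and it acts on the separated power series through `τ`. -/
structure IsAutomorphism (τ : AnnAut A I) (M : Struc.{u, v} A I) [Field M.K] (s : M.K ≃+* M.K) :
    Prop where
  sig_eq : ∀ x, M.sig x = s x
  sigRV_bijective : ∀ n, Function.Bijective (M.sigRV n)
  sigRV_rv : ∀ n x, M.sigRV n (M.rv n x) = M.rv n (s x)
  sigRV_rvMap : ∀ m n (h : m ∣ n) ξ, M.sigRV m (M.rvMap m n h ξ) = M.rvMap m n h (M.sigRV n ξ)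
  sigRV_rvDivR : ∀ ξ η, M.rvDivR (M.sigRV 1 ξ) (M.sigRV 1 η) ↔ M.rvDivR ξ η
  sig_ann : ∀ {m n} (f : Ann A I m n) x y,
    s (M.ann f x y) = M.ann (τ.toEquiv m n f) (fun i => s (x i)) (fun j => s (y j))

/-- The prolongation `x, σ x, …, σ^(N-1) x`. -/
def prol {K : Type v} [Field K] (s : K ≃+* K) (N : ℕ) (x : K) : Fin N → K := fun i => s^[i] x

/-- The open ball `{x | val (x - a) > val g}`. -/
def openBall {K : Type v} [Field K] (O : ValuationSubring K) (a g : K) : Set K :=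
  {x | O.valuation (x - a) < O.valuation g}

/-- `d` linearly approximates `f` at prolongations on `b`: for all distinct `a`, `c` in `b`,
`val (f (∇c) - f (∇a) - d · ∇(c - a)) > min_i (val d_i + val (σ^i (c - a)))`, or `d = 0` and `f` is
constant on the prolongations of `b`. -/
def LinearlyApproximates {K : Type v} [Field K] (O : ValuationSubring K) (s : K ≃+* K) {N : ℕ}
    (d : Fin N → K) (f : (Fin N → K) → K) (b : Set K) : Prop :=
  (∀ a ∈ b, ∀ c ∈ b, a ≠ c → ∃ i,
    O.valuation (f (prol s N c) - f (prol s N a) - ∑ j, d j * prol s N (c - a) j) <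
      O.valuation (d i * prol s N (c - a) i)) ∨
  (d = 0 ∧ ∀ a ∈ b, ∀ c ∈ b, f (prol s N a) = f (prol s N c))

/-- `(t, a, d, ξ)` is in `σ`-Hensel configuration, where `ξ = val g`. -/
def HenselConfiguration (M : Struc.{u, v} A I) [Field M.K] (O : ValuationSubring M.K)
    (s : M.K ≃+* M.K) {N : ℕ} (t : KTerm A I M.K N) (a : M.K) (d : Fin N → M.K) (g : M.K) : Prop :=
  LinearlyApproximates O s d (fun x => t.eval M x) (openBall O a g) ∧
    ∃ i, O.valuation (t.eval M (prol s N a)) < O.valuation (d i * s^[i] g)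

/-- `σ`-Henselianity: each `σ`-Hensel configuration `(t, a, d, ξ)` has a solution `c`, i.e.
`t (∇c) = 0`, with `val (c - a) ≥ max_i val (σ^(-i) (t (∇a) / d_i))`. -/
def IsSigmaHenselian (M : Struc.{u, v} A I) [Field M.K] (O : ValuationSubring M.K)
    (s : M.K ≃+* M.K) : Prop :=
  ∀ (N : ℕ) (t : KTerm A I M.K N) (a : M.K) (d : Fin N → M.K) (g : M.K), g ≠ 0 →
    HenselConfiguration M O s t a d g →
      ∃ c, t.eval M (prol s N c) = 0 ∧
        ∀ i, d i ≠ 0 →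
          O.valuation (c - a) ≤ O.valuation (s.symm^[i] (t.eval M (prol s N a) / d i))

/-- `M` is a model of the theory of `σ`-Henselian analytic fields with an automorphism and a
nontrivial value group, in characteristic `0` and residue characteristic `p`. The analytic structure
is given by a Noetherian ring `A`, separated and complete for its `I`-adic topology, and `τ` is the
given automorphism of the system of the rings `A⟨X⟩[[Y]]`. -/
def ModelsTAsH [IsNoetherianRing A] [IsAdicComplete I A] (τ : AnnAut A I) (p : ℕ)
    (M : Struc.{u, v} A I) : Prop :=
  ∃ (_ : Field M.K) (O R : ValuationSubring M.K) (s : M.K ≃+* M.K),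
    IsAnalyticField M O R ∧ IsAutomorphism τ M s ∧ IsSigmaHenselian M O s ∧
      O ≠ ⊤ ∧ CharP (IsLocalRing.ResidueField O) p

end Models

/-! ### The structure of a valued field -/

section OfValuedField

variable {K : Type v} [Field K]

/-- The subgroup `1 + n 𝔪` of `Kˣ`. -/
def onePlus (O : ValuationSubring K) (n : ℕ+) : Subgroup Kˣ where
  carrier := {u | ∃ μ, O.valuation μ < 1 ∧ (u : K) = 1 + ((n : ℕ) : K) * μ}
  one_mem' := ⟨0, by simp⟩
  mul_mem' := by
    rintro u w ⟨μ, hμ, hu⟩ ⟨ν, hν, hw⟩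
    have hn : O.valuation ((n : ℕ) : K) ≤ 1 := (O.valuation_le_one_iff _).2 (natCast_mem O _)
    refine ⟨μ + ν + (n : ℕ) * μ * ν, ?_, by rw [Units.val_mul, hu, hw]; ring⟩
    refine Valuation.map_add_lt _ (Valuation.map_add_lt _ hμ hν) ?_
    rw [map_mul, map_mul]
    exact mul_lt_one_of_nonneg_of_lt_one_right (mul_le_one' hn hμ.le) zero_le hν
  inv_mem' := by
    rintro u ⟨μ, hμ, hu⟩
    have hn : O.valuation ((n : ℕ) : K) ≤ 1 := (O.valuation_le_one_iff _).2 (natCast_mem O _)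
    have h1 : O.valuation (u : K) = 1 := by
      rw [hu]
      refine Valuation.map_one_add_of_lt _ ?_
      rw [map_mul]
      exact mul_lt_one_of_nonneg_of_lt_one_right hn zero_le hμ
    refine ⟨-(μ * (u : K)⁻¹), ?_, ?_⟩
    · rw [Valuation.map_neg, map_mul, map_inv₀, h1, inv_one, mul_one]
      exact hμ
    · have h0 : (u : K) ≠ 0 := u.ne_zero
      rw [Units.val_inv_eq_inv_val]
      field_simp
      rw [hu]
      ring

/-- The leading term sort `Kˣ / (1 + n 𝔪) ∪ {0}`. -/
abbrev LeadTerm (O : ValuationSubring K) (n : ℕ+) : Type v := WithZero (Kˣ ⧸ onePlus O n)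

open Classical in
/-- The canonical map from `K` to the leading term sort. -/
def LeadTerm.mk (O : ValuationSubring K) (n : ℕ+) (x : K) : LeadTerm O n :=
  if h : x = 0 then 0 else ((QuotientGroup.mk (Units.mk0 x h) : Kˣ ⧸ onePlus O n) : LeadTerm O n)

theorem LeadTerm.mk_surjective (O : ValuationSubring K) (n : ℕ+) :
    Function.Surjective (LeadTerm.mk O n) := by
  intro ξ
  induction ξ using WithZero.recZeroCoe with
  | zero => exact ⟨0, by simp [LeadTerm.mk]⟩
  | coe q =>
    obtain ⟨u, rfl⟩ := QuotientGroup.mk_surjective q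
    exact ⟨u, by simp [LeadTerm.mk]⟩

/-- A representative in `K` of a leading term. -/
def LeadTerm.rep {O : ValuationSubring K} {n : ℕ+} (ξ : LeadTerm O n) : K :=
  Function.surjInv (LeadTerm.mk_surjective O n) ξ

open Classical in
/-- The structure of a valued field `K` with valuation ring `O`, valuation subring `R`, the given
interpretation of the separated power series, and the automorphism `s`. What is induced by `K` on
the leading term sorts is computed on representatives. -/
def Struc.ofValuedField {A : Type u} [CommRing A] {I : Ideal A} (O R : ValuationSubring K)
    (annK : ∀ m n : ℕ, Ann A I m n → (Fin m → K) → (Fin n → K) → K) (s : K ≃+* K) :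
    Struc.{u, v} A I where
  K := K
  RV := LeadTerm O
  zero := 0
  one := 1
  add x y := x + y
  neg x := -x
  mul x y := x * y
  quot x y := if y = 0 then 0 else x / y
  rv := LeadTerm.mk O
  rvMap m _ _ ξ := LeadTerm.mk O m ξ.rep
  rvZero _ := 0
  rvOne _ := 1
  rvMul _ ξ η := ξ * η
  rvDiv _ ξ η := O.valuation η.rep ≤ O.valuation ξ.rep
  rvAdd m n _ ξ η :=
    if O.valuation ((n : ℕ) * ξ.rep) ≤ O.valuation ((m : ℕ) * (ξ.rep + η.rep)) ∧
        O.valuation ((n : ℕ) * η.rep) ≤ O.valuation ((m : ℕ) * (ξ.rep + η.rep))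
    then LeadTerm.mk O m (ξ.rep + η.rep) else 0
  rvDivR ξ η := R.valuation η.rep ≤ R.valuation ξ.rep
  ann {m n} f x y := annK m n f x y
  unitRV {m n} k E ξ η := LeadTerm.mk O k (annK m n E.1 (fun i => (ξ i).rep) (fun j => (η j).rep))
  sig x := s x
  sigRV n ξ := LeadTerm.mk O n (s ξ.rep)

end OfValuedField

/-! ### The Witt vectors -/

section Witt

/-- The value of a separated power series at a point of `Aᵐ × Iⁿ`: the sum
`∑ a_{μ,ν} x^μ y^ν` for the `I`-adic topology. -/
def Ann.eval {A : Type u} [CommRing A] {I : Ideal A} {m n : ℕ} (f : Ann A I m n)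
    (x : Fin m → A) (y : Fin n → A) : A :=
  letI : TopologicalSpace A := I.adicTopology
  ∑' e : Fin m ⊕ Fin n →₀ ℕ,
    MvPowerSeries.coeff e f.1 * e.prod fun i k => (Sum.elim x y i) ^ k

variable (p : ℕ) [Fact p.Prime]

/-- The ring of Witt vectors of the algebraic closure of `𝔽_p`. -/
abbrev WRing : Type := WittVector p (AlgebraicClosure (ZMod p))

/-- The field of Witt vectors of the algebraic closure of `𝔽_p`. -/
abbrev WField : Type := FractionRing (WRing p)

/-- The ideal `p W` of the ring of Witt vectors. -/
abbrev WIdeal : Ideal (WRing p) := Ideal.span {(p : WRing p)}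

/-- The ring of Witt vectors, as a valuation ring of its fraction field. -/
def WVal : ValuationSubring (WField p) :=
  ValuationSubring.ofSubring (algebraMap (WRing p) (WField p)).range fun x => by
    rcases ValuationRing.isInteger_or_isInteger (WRing p) x with h | h
    · exact Or.inl h
    · exact Or.inr h

/-- The automorphism of the field of Witt vectors that lifts the Frobenius automorphism. -/
def WFrob : WField p ≃+* WField p :=
  IsFractionRing.ringEquivOfRingEquiv (WittVector.frobeniusEquiv p (AlgebraicClosure (ZMod p)))

/-- The lift of the Frobenius automorphism acts on separated power series coefficientwise. -/
def WAnnAut : AnnAut (WRing p) (WIdeal p) :=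
  AnnAut.ofRingEquiv (WittVector.frobeniusEquiv p (AlgebraicClosure (ZMod p))) (by
    rw [Ideal.map_span, Set.image_singleton, map_natCast])

open Classical in
/-- The interpretation of separated power series over `W` in its fraction field: the sum of the
series at the points of `Wᵐ × (p W)ⁿ`, and `0` at the other points. -/
def WAnn (m n : ℕ) (f : Ann (WRing p) (WIdeal p) m n) (x : Fin m → WField p)
    (y : Fin n → WField p) : WField p :=
  if InDomain (WVal p) x y then
    algebraMap (WRing p) (WField p)
      (Ann.eval f (fun i => Function.invFun (algebraMap (WRing p) (WField p)) (x i))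
        (fun j => Function.invFun (algebraMap (WRing p) (WField p)) (y j)))
  else 0

/-- The field of Witt vectors of the algebraic closure of `𝔽_p`, with its valuation, the analytic
structure of the separated power series over `W`, and the lift of the Frobenius automorphism. -/
def WStruc : Struc (WRing p) (WIdeal p) :=
  Struc.ofValuedField (WVal p) (WVal p) (WAnn p) (WFrob p)

end Witt

end AnalyticDifference

/-! Three things have to be seen: that summing power series gives an analytic structure, that
everything on the `RV` sorts is well defined, and that the field is `σ`-Henselian.

Since `W` is complete and Hausdorff for the `p`-adic topology, a separated power series is summable
at each point of `W^m × (pW)^n`. Evaluation is then a ring morphism compatible with inclusions of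
variables (`Ann.eval_mul`, `Ann.eval_incl`) and with the Frobenius lift, which is `p`-adically
continuous (`Ann.map_eval`). For the traces of units, points with equal images in `RV_k` are
congruent modulo `kpW`, so are the values of a series there, and a congruence between unit values
modulo `kpW` is equality in `RV_k` (`mk_WAnn_unit`). The other symbols on `RV` reduce to
independence of representatives, where `σ` being an isometry and `+_{m,n}` being well defined
(`LeadTerm.mk_add`) are the points to check.

`σ`-Henselianity is a Newton iteration valid for any linearly approximated function `F`. Because `σ`
preserves `v`, the term `min_i (v(d_i) + v(σ^i z))` equals `v(D z)`, where `D` is a coefficient of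
least additive valuation. Because `v` is discrete, a strict inequality of valuations gains a factor
`p`. The linearised equation `e + ∑ d_j σ^j(z) = 0` is solved modulo `p e`: with `z = (e / D) u` its
reduction becomes `1 + ∑ c_j u^(p^j) = 0` with some `c_j` nonzero, which has a root because the
residue field is algebraically closed (`exists_valuation_add_sum_le`). Each correction thus improves
`F(x)` by a factor `p`, the corrections form a convergent `p`-adic series, and its limit is a zero
(`exists_eq_zero_of_approx`). -/

namespace AnalyticDifference

/-! ### Evaluation of separated power series in an adically complete ring. -/

section Evaluation

universe u
variable {A : Type u} [CommRing A] {I : Ideal A} {m n : ℕ}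

/-- The value of the monomial with exponent `e` at `(x, y)`. -/
def monomialValue (x : Fin m → A) (y : Fin n → A) (e : Fin m ⊕ Fin n →₀ ℕ) : A :=
  e.prod fun i k => (Sum.elim x y i) ^ k

theorem monomialValue_add (x : Fin m → A) (y : Fin n → A) (e e' : Fin m ⊕ Fin n →₀ ℕ) :
    monomialValue x y (e + e') = monomialValue x y e * monomialValue x y e' :=
  Finsupp.prod_add_index' (fun _ => pow_zero _) fun _ _ _ => pow_add _ _ _

theorem monomialValue_sumElim (x : Fin m → A) (y : Fin n → A) (μ : Fin m →₀ ℕ) (ν : Fin n →₀ ℕ) :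
    monomialValue x y (Finsupp.sumElim μ ν) = (∏ i, x i ^ μ i) * ∏ j, y j ^ ν j := by
  rw [monomialValue, Finsupp.prod_fintype _ _ fun _ => pow_zero _, Fintype.prod_sum_type]
  simp

theorem exists_sumElim (e : Fin m ⊕ Fin n →₀ ℕ) :
    ∃ (μ : Fin m →₀ ℕ) (ν : Fin n →₀ ℕ), Finsupp.sumElim μ ν = e := by
  refine ⟨e.comapDomain Sum.inl Sum.inl_injective.injOn,
    e.comapDomain Sum.inr Sum.inr_injective.injOn, ?_⟩
  ext i
  cases i <;> rfl

theorem monomialValue_mem_pow (x : Fin m → A) {y : Fin n → A} (hy : ∀ j, y j ∈ I)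
    (μ : Fin m →₀ ℕ) (ν : Fin n →₀ ℕ) :
    monomialValue x y (Finsupp.sumElim μ ν) ∈ I ^ ∑ j, ν j := by
  rw [monomialValue_sumElim, ← Finset.prod_pow_eq_pow_sum]
  exact Ideal.mul_mem_left _ _ (Ideal.prod_mem_prod fun j _ => Ideal.pow_mem_pow (hy j) _)

/-- If some entry of `ν` is at least `k`, the factor `y^ν` already lies in `I ^ k`. Only finitely
many `ν` remain, and for each of them the defining condition of `Ann` leaves finitely many `μ`. -/
theorem Ann.finite_term_notMem (f : Ann A I m n) (x : Fin m → A) {y : Fin n → A}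
    (hy : ∀ j, y j ∈ I) (k : ℕ) :
    {e | MvPowerSeries.coeff e f.1 * monomialValue x y e ∉ I ^ k}.Finite := by
  have hfin : {ν : Fin n →₀ ℕ | ∀ j, ν j < k}.Finite := by
    refine Set.Finite.of_finite_image (f := fun ν : Fin n →₀ ℕ => (ν : Fin n → ℕ))
      ((Set.Finite.pi' fun _ : Fin n => Set.finite_Iio k).subset ?_) DFunLike.coe_injective.injOn
    rintro _ ⟨ν, hν, rfl⟩
    exact hν
  refine (hfin.biUnion fun ν _ => (f.2 ν k).image fun μ => Finsupp.sumElim μ ν).subset ?_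
  intro e he
  obtain ⟨μ, ν, rfl⟩ := exists_sumElim e
  simp only [Set.mem_iUnion]
  refine ⟨ν, fun j => ?_, μ, fun h => he (Ideal.mul_mem_right _ _ h), rfl⟩
  by_contra hj
  refine he (Ideal.mul_mem_left _ _ (Ideal.pow_le_pow_right ?_ (monomialValue_mem_pow x hy μ ν)))
  exact (not_lt.1 hj).trans (Finset.single_le_sum (fun _ _ => Nat.zero_le _) (Finset.mem_univ j))

variable [IsAdicComplete I A]

variable (I) in
-- The `WithIdeal` instance carries the same `I`-adic topology as the one inside `Ann.eval`, so the
-- topological theory of sums becomes available for it.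
theorem completeSpace_and_t2Space_adic :
    letI : WithIdeal A := ⟨I⟩
    CompleteSpace A ∧ T2Space A := by
  let _ : WithIdeal A := ⟨I⟩
  have h : IsAdic I := rfl
  exact h.isAdicComplete_iff.1 inferInstance

/-- In a complete nonarchimedean group a family is summable as soon as it tends to `0` along the
cofinite filter. -/
theorem Ann.hasSum_eval (f : Ann A I m n) (x : Fin m → A) {y : Fin n → A} (hy : ∀ j, y j ∈ I) :
    letI : WithIdeal A := ⟨I⟩
    HasSum (fun e => MvPowerSeries.coeff e f.1 * monomialValue x y e) (Ann.eval f x y) := by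
  let _ : WithIdeal A := ⟨I⟩
  obtain ⟨_, _⟩ := completeSpace_and_t2Space_adic I
  have h : Summable (fun e => MvPowerSeries.coeff e f.1 * monomialValue x y e) := by
    refine NonarchimedeanAddGroup.summable_of_tendsto_cofinite_zero ?_
    rw [I.hasBasis_nhds_zero_adic.tendsto_right_iff]
    intro k _
    rw [Filter.eventually_cofinite]
    exact Ann.finite_term_notMem f x hy k
  exact h.hasSum

theorem Ann.eval_eq_of_hasSum (f : Ann A I m n) (x : Fin m → A) {y : Fin n → A}
    (hy : ∀ j, y j ∈ I) {a : A}
    (h : letI : WithIdeal A := ⟨I⟩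
      HasSum (fun e => MvPowerSeries.coeff e f.1 * monomialValue x y e) a) :
    Ann.eval f x y = a := by
  let _ : WithIdeal A := ⟨I⟩
  obtain ⟨_, _⟩ := completeSpace_and_t2Space_adic I
  exact (Ann.hasSum_eval f x hy).unique h

theorem Ann.eval_one (x : Fin m → A) {y : Fin n → A} (hy : ∀ j, y j ∈ I) :
    Ann.eval (1 : Ann A I m n) x y = 1 := by
  classical
  refine Ann.eval_eq_of_hasSum _ x hy ?_
  let _ : WithIdeal A := ⟨I⟩
  convert hasSum_single (0 : Fin m ⊕ Fin n →₀ ℕ) ?_ using 1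
  · simp [monomialValue]
  · intro e he
    simp [MvPowerSeries.coeff_one, he]

theorem Ann.eval_add (f g : Ann A I m n) (x : Fin m → A) {y : Fin n → A} (hy : ∀ j, y j ∈ I) :
    Ann.eval (f + g) x y = Ann.eval f x y + Ann.eval g x y := by
  refine Ann.eval_eq_of_hasSum _ x hy ?_
  let _ : WithIdeal A := ⟨I⟩
  simpa [add_mul] using (Ann.hasSum_eval f x hy).add (Ann.hasSum_eval g x hy)

theorem coeff_mul_mul_monomialValue [DecidableEq (Fin m ⊕ Fin n)]
    (f g : MvPowerSeries (Fin m ⊕ Fin n) A) (x : Fin m → A)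
    (y : Fin n → A) (e : Fin m ⊕ Fin n →₀ ℕ) :
    MvPowerSeries.coeff e (f * g) * monomialValue x y e =
      ∑ q ∈ Finset.HasAntidiagonal.antidiagonal e, MvPowerSeries.coeff q.1 f * monomialValue x y q.1 *
        (MvPowerSeries.coeff q.2 g * monomialValue x y q.2) := by
  rw [MvPowerSeries.coeff_mul, Finset.sum_mul]
  refine Finset.sum_congr rfl fun q hq => ?_
  rw [← Finset.HasAntidiagonal.mem_antidiagonal.1 hq, monomialValue_add]
  ring

/-- Products of summable families are summable in the nonarchimedean setting, so the Cauchy product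
may be regrouped along antidiagonals. -/
theorem Ann.eval_mul (f g : Ann A I m n) (x : Fin m → A) {y : Fin n → A} (hy : ∀ j, y j ∈ I) :
    Ann.eval (f * g) x y = Ann.eval f x y * Ann.eval g x y := by
  classical
  let _ : WithIdeal A := ⟨I⟩
  obtain ⟨_, _⟩ := completeSpace_and_t2Space_adic I
  have hf := Ann.hasSum_eval f x hy
  have hg := Ann.hasSum_eval g x hy
  have h1 := hf.summable.mul_of_nonarchimedean hg.summable
  have h2 := hf.summable.tsum_mul_tsum_eq_tsum_sum_antidiagonal hg.summable h1
  rw [hf.tsum_eq, hg.tsum_eq] at h2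
  have hfg := Ann.hasSum_eval (f * g) x hy
  rw [h2, ← hfg.tsum_eq]
  refine tsum_congr fun e => ?_
  have h3 := coeff_mul_mul_monomialValue f.1 g.1 x y e
  rw [← h3, Subring.coe_mul]

theorem Ann.eval_X (i : Fin m) (x : Fin m → A) {y : Fin n → A} (hy : ∀ j, y j ∈ I) :
    Ann.eval (Ann.X A I i : Ann A I m n) x y = x i := by
  classical
  refine Ann.eval_eq_of_hasSum _ x hy ?_
  let _ : WithIdeal A := ⟨I⟩
  convert hasSum_single (Finsupp.single (Sum.inl i) 1 : Fin m ⊕ Fin n →₀ ℕ) ?_ using 1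
  · simp [monomialValue, Ann.X]
  · intro e he
    simp [MvPowerSeries.coeff_X, he, Ann.X]

theorem Ann.eval_Y (j : Fin n) (x : Fin m → A) {y : Fin n → A} (hy : ∀ j, y j ∈ I) :
    Ann.eval (Ann.Y A I j : Ann A I m n) x y = y j := by
  classical
  refine Ann.eval_eq_of_hasSum _ x hy ?_
  let _ : WithIdeal A := ⟨I⟩
  convert hasSum_single (Finsupp.single (Sum.inr j) 1 : Fin m ⊕ Fin n →₀ ℕ) ?_ using 1
  · simp [monomialValue, Ann.Y]
  · intro e he
    simp [MvPowerSeries.coeff_X, he, Ann.Y]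

theorem Ann.eval_const (a : A) (x y : Fin 0 → A) : Ann.eval (Ann.const A I a) x y = a := by
  classical
  refine Ann.eval_eq_of_hasSum _ x (fun j => j.elim0) ?_
  let _ : WithIdeal A := ⟨I⟩
  convert hasSum_single (0 : Fin 0 ⊕ Fin 0 →₀ ℕ) ?_ using 1
  · simp [monomialValue, Ann.const]
  · intro e he
    exact absurd (Subsingleton.elim e 0) he

/-- The renamed series has coefficient `0` at exponents outside the image of the embedding, so its
sum is the original one reindexed. -/
theorem Ann.eval_incl {m' n' : ℕ} (hm : m ≤ m') (hn : n ≤ n') (f : Ann A I m n)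
    (x : Fin m' → A) {y : Fin n' → A} (hy : ∀ j, y j ∈ I) :
    Ann.eval (Ann.incl A I hm hn f) x y =
      Ann.eval f (fun i => x (Fin.castLE hm i)) (fun j => y (Fin.castLE hn j)) := by
  refine Ann.eval_eq_of_hasSum _ x hy ?_
  let _ : WithIdeal A := ⟨I⟩
  refine ((Finsupp.embDomain_injective (varEmb hm hn)).hasSum_iff ?_).1 ?_
  · intro e he
    change MvPowerSeries.coeff e (MvPowerSeries.rename (varEmb hm hn) f.1) * _ = 0
    rw [MvPowerSeries.coeff_rename_eq_zero, zero_mul]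
    rintro ⟨e', rfl⟩
    exact he ⟨e', Finsupp.embDomain_eq_mapDomain _ _⟩
  · convert Ann.hasSum_eval f (fun i => x (Fin.castLE hm i))
      (y := fun j => y (Fin.castLE hn j)) (fun j => hy _) using 1
    funext e
    change MvPowerSeries.coeff _ (MvPowerSeries.rename (varEmb hm hn) f.1) * _ = _
    rw [MvPowerSeries.coeff_embDomain_rename, monomialValue, Finsupp.prod_embDomain]
    congr 1
    refine Finsupp.prod_congr fun i _ => ?_
    cases i <;> rfl

/-- Since `φ` preserves every `I ^ k` it is continuous, and hence may be applied to the sum term by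
term. -/
theorem Ann.map_eval (φ : A ≃+* A) (hφ : I.map (φ : A →+* A) = I) (f : Ann A I m n)
    (x : Fin m → A) {y : Fin n → A} (hy : ∀ j, y j ∈ I) :
    φ (Ann.eval f x y) = Ann.eval ((AnnAut.ofRingEquiv φ hφ).toEquiv m n f)
      (fun i => φ (x i)) (fun j => φ (y j)) := by
  have hmem : ∀ j, φ (y j) ∈ I := fun j => by
    simpa using (map_mem_pow_iff φ hφ 1 (y j)).2 (by simpa using hy j)
  refine (Ann.eval_eq_of_hasSum _ _ hmem ?_).symm
  let _ : WithIdeal A := ⟨I⟩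
  have hcont : Continuous φ := by
    refine continuous_of_continuousAt_zero φ ?_
    rw [ContinuousAt, map_zero, I.hasBasis_nhds_zero_adic.tendsto_iff I.hasBasis_nhds_zero_adic]
    exact fun k _ => ⟨k, trivial, fun a ha => (map_mem_pow_iff φ hφ k a).2 ha⟩
  convert (Ann.hasSum_eval f x hy).map φ hcont using 1
  funext e
  change MvPowerSeries.coeff e (MvPowerSeries.map (φ : A →+* A) f.1) * _ = φ (_ * _)
  rw [map_mul, MvPowerSeries.coeff_map, monomialValue, monomialValue, Finsupp.prod, Finsupp.prod,
    map_prod]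
  congr 1
  refine Finset.prod_congr rfl fun i _ => ?_
  cases i <;> simp

/-- The values of a series at points congruent modulo `J` are congruent modulo `J`. -/
theorem Ann.eval_sub_eval_mem (f : Ann A I m n) {x x' : Fin m → A} {y y' : Fin n → A}
    (hy : ∀ j, y j ∈ I) (hy' : ∀ j, y' j ∈ I) {J : Ideal A} {k : ℕ} (hJ : I ^ k ≤ J)
    (hxx' : ∀ i, x i - x' i ∈ J) (hyy' : ∀ j, y j - y' j ∈ J) :
    Ann.eval f x y - Ann.eval f x' y' ∈ J := by
  let _ : WithIdeal A := ⟨I⟩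
  -- Containing `I ^ k`, the ideal `J` is an open subgroup, hence closed: congruences between
  -- partial sums pass to the limit, and for a single monomial they hold in the quotient `A ⧸ J`.
  have hclosed : IsClosed (J : Set A) := by
    refine AddSubgroup.isClosed_of_isOpen J.toAddSubgroup
      (AddSubgroup.isOpen_of_mem_nhds (g := 0) _ ?_)
    exact I.hasBasis_nhds_zero_adic.mem_iff.2 ⟨k, trivial, hJ⟩
  refine hclosed.mem_of_tendsto ((Ann.hasSum_eval f x hy).sub (Ann.hasSum_eval f x' hy'))
    (Filter.Eventually.of_forall fun s => J.sum_mem fun e _ => ?_)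
  rw [← mul_sub]
  refine J.mul_mem_left _ ?_
  rw [← Ideal.Quotient.eq, monomialValue, monomialValue, Finsupp.prod, Finsupp.prod, map_prod,
    map_prod]
  refine Finset.prod_congr rfl fun i _ => ?_
  rw [map_pow, map_pow]
  congr 1
  rw [Ideal.Quotient.eq]
  cases i
  · exact hxx' _
  · exact hyy' _

end Evaluation

/-! ### The leading term sorts: independence of representatives. -/

section LeadingTerms

universe u v
variable {K : Type v} [Field K] (O : ValuationSubring K)

variable {O} in
theorem valuation_natCast_mul_lt_one {μ : K} (hμ : O.valuation μ < 1) (n : ℕ) :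
    O.valuation ((n : K) * μ) < 1 := by
  rw [map_mul]
  exact mul_lt_one_of_nonneg_of_lt_one_right
    ((O.valuation_le_one_iff _).2 (natCast_mem O _)) zero_le hμ

variable {O} in
theorem valuation_one_add_natCast_mul {μ : K} (hμ : O.valuation μ < 1) (n : ℕ) :
    O.valuation (1 + (n : K) * μ) = 1 :=
  Valuation.map_one_add_of_lt _ (valuation_natCast_mul_lt_one hμ n)

theorem LeadTerm.mk_zero (n : ℕ+) : LeadTerm.mk O n 0 = 0 := by simp [LeadTerm.mk]

theorem LeadTerm.mk_one (n : ℕ+) : LeadTerm.mk O n 1 = 1 := by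
  have h : Units.mk0 (1 : K) one_ne_zero = 1 := by ext; rfl
  rw [LeadTerm.mk, dif_neg one_ne_zero, h, QuotientGroup.mk_one, WithZero.coe_one]

theorem LeadTerm.mk_mul (n : ℕ+) (x y : K) :
    LeadTerm.mk O n (x * y) = LeadTerm.mk O n x * LeadTerm.mk O n y := by
  by_cases hx : x = 0
  · rw [hx, zero_mul, LeadTerm.mk_zero]
    rfl
  by_cases hy : y = 0
  · rw [hy, mul_zero, LeadTerm.mk_zero]
    rw [LeadTerm.mk, dif_neg hx]
    rfl
  rw [LeadTerm.mk, LeadTerm.mk, LeadTerm.mk, dif_neg hx, dif_neg hy, dif_neg (mul_ne_zero hx hy),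
    Units.mk0_mul, QuotientGroup.mk_mul, WithZero.coe_mul]

theorem LeadTerm.mk_eq_iff (n : ℕ+) (x y : K) : LeadTerm.mk O n x = LeadTerm.mk O n y ↔
    (x = 0 ∧ y = 0) ∨
      (x ≠ 0 ∧ y ≠ 0 ∧ ∃ μ, O.valuation μ < 1 ∧ x = y * (1 + ((n : ℕ) : K) * μ)) := by
  by_cases hx : x = 0
  · by_cases hy : y = 0
    · simp [hx, hy]
    · simp [hx, hy, LeadTerm.mk]
  by_cases hy : y = 0
  · simp [hx, hy, LeadTerm.mk]
  rw [eq_comm, LeadTerm.mk, LeadTerm.mk, dif_neg hx, dif_neg hy, WithZero.coe_inj,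
    QuotientGroup.eq]
  simp only [hx, hy, false_and, ne_eq, not_false_eq_true, true_and, false_or]
  refine exists_congr fun μ => and_congr_right fun _ => ?_
  rw [Units.val_mul, Units.val_inv_eq_inv_val, Units.val_mk0, Units.val_mk0,
    inv_mul_eq_iff_eq_mul₀ hy]

theorem LeadTerm.exists_of_mk_eq {n : ℕ+} {x y : K} (h : LeadTerm.mk O n x = LeadTerm.mk O n y) :
    ∃ μ, O.valuation μ < 1 ∧ x = y * (1 + ((n : ℕ) : K) * μ) := by
  rcases (LeadTerm.mk_eq_iff O n x y).1 h with ⟨hx, hy⟩ | ⟨_, _, h⟩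
  · exact ⟨0, by simp, by simp [hx, hy]⟩
  · exact h

theorem LeadTerm.mk_mul_one_add (n : ℕ+) (x : K) {μ : K} (hμ : O.valuation μ < 1) :
    LeadTerm.mk O n (x * (1 + ((n : ℕ) : K) * μ)) = LeadTerm.mk O n x := by
  rw [LeadTerm.mk_eq_iff]
  by_cases hx : x = 0
  · simp [hx]
  refine Or.inr ⟨mul_ne_zero hx ?_, hx, μ, hμ, rfl⟩
  rw [← (O.valuation).ne_zero_iff, valuation_one_add_natCast_mul hμ]
  exact one_ne_zero

variable {O} in
theorem LeadTerm.mk_rep {n : ℕ+} (ξ : LeadTerm O n) : LeadTerm.mk O n ξ.rep = ξ :=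
  Function.surjInv_eq (LeadTerm.mk_surjective O n) ξ

theorem LeadTerm.valuation_eq_of_mk_eq {n : ℕ+} {x y : K}
    (h : LeadTerm.mk O n x = LeadTerm.mk O n y) : O.valuation x = O.valuation y := by
  obtain ⟨μ, hμ, rfl⟩ := LeadTerm.exists_of_mk_eq O h
  rw [map_mul, valuation_one_add_natCast_mul hμ, mul_one]

theorem LeadTerm.valuation_rep_mk (n : ℕ+) (x : K) :
    O.valuation (LeadTerm.mk O n x).rep = O.valuation x :=
  LeadTerm.valuation_eq_of_mk_eq O (LeadTerm.mk_rep _)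

theorem LeadTerm.mk_eq_of_dvd {m n : ℕ+} (hmn : m ∣ n) {x y : K}
    (h : LeadTerm.mk O n x = LeadTerm.mk O n y) : LeadTerm.mk O m x = LeadTerm.mk O m y := by
  obtain ⟨μ, hμ, rfl⟩ := LeadTerm.exists_of_mk_eq O h
  obtain ⟨c, rfl⟩ := hmn
  rw [PNat.mul_coe, Nat.cast_mul, mul_assoc]
  exact LeadTerm.mk_mul_one_add O m y (valuation_natCast_mul_lt_one hμ _)

/-- An isometric automorphism fixes the integer `n`, so it maps `1 + n 𝔪` into itself. The converse
is the same fact for `s.symm`, which is why `key` quantifies over the automorphism. -/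
theorem LeadTerm.mk_map_eq_iff (s : K ≃+* K) (hs : ∀ x, O.valuation (s x) = O.valuation x)
    (n : ℕ+) (x y : K) : LeadTerm.mk O n (s x) = LeadTerm.mk O n (s y) ↔
      LeadTerm.mk O n x = LeadTerm.mk O n y := by
  have key : ∀ (s : K ≃+* K) (_ : ∀ x, O.valuation (s x) = O.valuation x) (x y : K),
      LeadTerm.mk O n x = LeadTerm.mk O n y → LeadTerm.mk O n (s x) = LeadTerm.mk O n (s y) := by
    intro s hs x y h
    obtain ⟨μ, hμ, rfl⟩ := LeadTerm.exists_of_mk_eq O h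
    rw [map_mul, map_add, map_mul, map_one, map_natCast]
    exact LeadTerm.mk_mul_one_add O n (s y) ((hs μ).trans_lt hμ)
  refine ⟨fun h => ?_, key s hs x y⟩
  simpa using key s.symm (fun z => by rw [← hs, s.apply_symm_apply]) _ _ h

theorem LeadTerm.valuation_rep_mk_le_iff (n : ℕ+) (x y : K) :
    O.valuation (LeadTerm.mk O n y).rep ≤ O.valuation (LeadTerm.mk O n x).rep ↔
      O.valuation y ≤ O.valuation x := by
  rw [LeadTerm.valuation_rep_mk, LeadTerm.valuation_rep_mk]

variable [CharZero K]

/-- Changing representatives alters `x + y` by `n x μ + n y ν`; the two inequalities say exactly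
what is needed for this error to lie in `m (x + y) 𝔪`. -/
theorem LeadTerm.mk_add {m n : ℕ+} {x y x' y' : K}
    (hx : LeadTerm.mk O n x' = LeadTerm.mk O n x) (hy : LeadTerm.mk O n y' = LeadTerm.mk O n y)
    (h₁ : O.valuation ((n : ℕ) * x) ≤ O.valuation ((m : ℕ) * (x + y)))
    (h₂ : O.valuation ((n : ℕ) * y) ≤ O.valuation ((m : ℕ) * (x + y))) :
    LeadTerm.mk O m (x' + y') = LeadTerm.mk O m (x + y) := by
  obtain ⟨μ, hμ, rfl⟩ := LeadTerm.exists_of_mk_eq O hx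
  obtain ⟨ν, hν, rfl⟩ := LeadTerm.exists_of_mk_eq O hy
  have hn : ((n : ℕ) : K) ≠ 0 := Nat.cast_ne_zero.2 n.ne_zero
  have hm : ((m : ℕ) : K) ≠ 0 := Nat.cast_ne_zero.2 m.ne_zero
  -- When the sum vanishes, the inequalities force `x = y = 0`, because `n ≠ 0` in characteristic
  -- zero.
  by_cases hxy : x + y = 0
  · rw [hxy, mul_zero, map_zero, nonpos_iff_eq_zero, map_eq_zero] at h₁ h₂
    obtain rfl : x = 0 := (mul_eq_zero.1 h₁).resolve_left hn
    obtain rfl : y = 0 := (mul_eq_zero.1 h₂).resolve_left hn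
    simp
  have hmxy : ((m : ℕ) : K) * (x + y) ≠ 0 := mul_ne_zero hm hxy
  have hpos : 0 < O.valuation (((m : ℕ) : K) * (x + y)) := (O.valuation.pos_iff).2 hmxy
  have key : ∀ {z ρ : K}, O.valuation z ≤ O.valuation (((m : ℕ) : K) * (x + y)) →
      O.valuation ρ < 1 → O.valuation (z * ρ) < O.valuation (((m : ℕ) : K) * (x + y)) := by
    intro z ρ hz hρ
    rw [map_mul]
    calc O.valuation z * O.valuation ρ
        ≤ O.valuation (((m : ℕ) : K) * (x + y)) * O.valuation ρ := mul_le_mul_left hz _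
      _ < O.valuation (((m : ℕ) : K) * (x + y)) * 1 := mul_lt_mul_of_pos_left hρ hpos
      _ = _ := mul_one _
  have hlt := Valuation.map_add_lt O.valuation (key h₁ hμ) (key h₂ hν)
  have hρ : O.valuation ((((n : ℕ) : K) * x * μ + (n : ℕ) * y * ν) / ((m : ℕ) * (x + y))) < 1 := by
    rw [map_div₀]
    exact (div_lt_one₀ hpos).2 hlt
  rw [← LeadTerm.mk_mul_one_add O m (x + y) hρ]
  congr 1
  field_simp
  ring

/-- The condition deciding whether `+_{m,n}` takes its default value `0` does not depend on
representatives either: by `mk_add` the two sums have equal leading terms, hence equal valuations.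
-/
theorem LeadTerm.add_valuation_le {m n : ℕ+} {x y x' y' : K}
    (hx : LeadTerm.mk O n x' = LeadTerm.mk O n x) (hy : LeadTerm.mk O n y' = LeadTerm.mk O n y)
    (h : O.valuation ((n : ℕ) * x) ≤ O.valuation ((m : ℕ) * (x + y)) ∧
      O.valuation ((n : ℕ) * y) ≤ O.valuation ((m : ℕ) * (x + y))) :
    O.valuation ((n : ℕ) * x') ≤ O.valuation ((m : ℕ) * (x' + y')) ∧
      O.valuation ((n : ℕ) * y') ≤ O.valuation ((m : ℕ) * (x' + y')) := by
  simpa only [map_mul, LeadTerm.valuation_eq_of_mk_eq O hx, LeadTerm.valuation_eq_of_mk_eq O hy,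
    LeadTerm.valuation_eq_of_mk_eq O (LeadTerm.mk_add O hx hy h.1 h.2)] using h

theorem isValuedField_ofValuedField {A : Type u} [CommRing A] {I : Ideal A}
    (R : ValuationSubring K)
    (annK : ∀ m n : ℕ, Ann A I m n → (Fin m → K) → (Fin n → K) → K) (s : K ≃+* K) :
    @IsValuedField A _ I (Struc.ofValuedField O R annK s) (inferInstance : Field K) O :=
  let _ : Field (Struc.ofValuedField O R annK s).K := ‹Field K›
  { zero_eq := rfl
    one_eq := rfl
    add_eq := fun _ _ => rfl
    neg_eq := fun _ => rfl
    mul_eq := fun _ _ => rfl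
    charZero := ‹CharZero K›
    rv_surjective := LeadTerm.mk_surjective O
    rv_eq_iff := LeadTerm.mk_eq_iff O
    rvMap_rv := fun _ _ h _ => LeadTerm.mk_eq_of_dvd O h (LeadTerm.mk_rep _)
    rvZero_eq := fun n => (LeadTerm.mk_zero O n).symm
    rvOne_eq := fun n => (LeadTerm.mk_one O n).symm
    rvMul_rv := fun n x y => (LeadTerm.mk_mul O n x y).symm
    rvDiv_rv := LeadTerm.valuation_rep_mk_le_iff O
    rvAdd_rv := fun _ _ _ _ _ h₁ h₂ =>
      (if_pos (LeadTerm.add_valuation_le O (LeadTerm.mk_rep _) (LeadTerm.mk_rep _)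
        ⟨h₁, h₂⟩)).trans
        (LeadTerm.mk_add O (LeadTerm.mk_rep _) (LeadTerm.mk_rep _) h₁ h₂)
    rvAdd_rv_of_not := fun _ _ _ _ _ h => if_neg fun h' => h
      (LeadTerm.add_valuation_le O (LeadTerm.mk_rep _).symm (LeadTerm.mk_rep _).symm h') }

end LeadingTerms

/-! ### The valuation of the Witt field and its invariance under Frobenius. -/

section WittValuation

variable (p : ℕ) [Fact p.Prime]

theorem algebraMap_WField_injective : Function.Injective (algebraMap (WRing p) (WField p)) :=
  IsFractionRing.injective _ _

/-- Write a positive integer as `p^r c` with `p ∤ c`: `p` is nonzero in the domain `W`, and `c` is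
already nonzero in the residue field. -/
instance charZero_WRing : CharZero (WRing p) := by
  refine charZero_of_inj_zero fun n hn => ?_
  by_contra h0
  obtain ⟨r, c, hc, rfl⟩ := Nat.exists_eq_pow_mul_and_not_dvd h0 p (Fact.out : p.Prime).ne_one
  rw [Nat.cast_mul, Nat.cast_pow] at hn
  have hp : (p : WRing p) ≠ 0 := WittVector.p_nonzero p _
  have h := congrArg WittVector.constantCoeff ((mul_eq_zero.1 hn).resolve_left (pow_ne_zero r hp))
  rw [map_natCast, map_zero, CharP.cast_eq_zero_iff (AlgebraicClosure (ZMod p)) p] at h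
  exact hc h

instance charZero_WField : CharZero (WField p) :=
  charZero_of_injective_algebraMap (algebraMap_WField_injective p)

variable {p}

theorem mem_WVal {x : WField p} : x ∈ WVal p ↔ ∃ w, algebraMap (WRing p) (WField p) w = x :=
  Iff.rfl

theorem WVal_valuation_le_iff {x y : WField p} : (WVal p).valuation x ≤ (WVal p).valuation y ↔
    ∃ w, algebraMap (WRing p) (WField p) w * y = x := by
  rw [ValuationSubring.valuation_le_iff]
  constructor
  · rintro ⟨⟨_, w, rfl⟩, h⟩
    exact ⟨w, h⟩
  · rintro ⟨w, h⟩
    exact ⟨⟨_, w, rfl⟩, h⟩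

theorem WVal_valuation_algebraMap_le_one (w : WRing p) :
    (WVal p).valuation (algebraMap (WRing p) (WField p) w) ≤ 1 :=
  ((WVal p).valuation_le_one_iff _).2 ⟨w, rfl⟩

theorem mem_WIdeal_iff {w : WRing p} : w ∈ WIdeal p ↔ ¬ IsUnit w := by
  rw [WIdeal, ← (WittVector.irreducible p).maximalIdeal_eq]
  exact IsLocalRing.mem_maximalIdeal w

theorem WVal_valuation_algebraMap_lt_one_iff {w : WRing p} :
    (WVal p).valuation (algebraMap (WRing p) (WField p) w) < 1 ↔ w ∈ WIdeal p := by
  rw [mem_WIdeal_iff, ← not_le, not_iff_not, ← map_one (WVal p).valuation, WVal_valuation_le_iff,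
    isUnit_iff_exists_inv']
  refine exists_congr fun w' => ?_
  rw [← map_mul, ← map_one (algebraMap (WRing p) (WField p)),
    (algebraMap_WField_injective p).eq_iff]

theorem WVal_valuation_lt_one_iff {x : WField p} : (WVal p).valuation x < 1 ↔
    ∃ w ∈ WIdeal p, algebraMap (WRing p) (WField p) w = x := by
  constructor
  · intro h
    obtain ⟨w, rfl⟩ := mem_WVal.1 (((WVal p).valuation_le_one_iff x).1 h.le)
    exact ⟨w, WVal_valuation_algebraMap_lt_one_iff.1 h, rfl⟩
  · rintro ⟨w, hw, rfl⟩
    exact WVal_valuation_algebraMap_lt_one_iff.2 hw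

theorem WVal_valuation_lt_iff {x y : WField p} : (WVal p).valuation x < (WVal p).valuation y ↔
    ∃ w ∈ WIdeal p, y ≠ 0 ∧ x = algebraMap (WRing p) (WField p) w * y := by
  by_cases hy : y = 0
  · simp [hy]
  rw [← div_lt_one₀ ((WVal p).valuation.pos_iff.2 hy), ← map_div₀, WVal_valuation_lt_one_iff]
  refine exists_congr fun w => and_congr_right fun _ => ?_
  rw [eq_div_iff hy, eq_comm (a := x)]
  simp [hy]

/-- The valuation of the field of Witt vectors is discrete. -/
theorem WVal_valuation_le_natCast_mul_of_lt {x y : WField p}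
    (h : (WVal p).valuation x < (WVal p).valuation y) :
    (WVal p).valuation x ≤ (WVal p).valuation ((p : WField p) * y) := by
  obtain ⟨w, hw, _, rfl⟩ := WVal_valuation_lt_iff.1 h
  obtain ⟨w, rfl⟩ := Ideal.mem_span_singleton'.1 hw
  rw [WVal_valuation_le_iff]
  exact ⟨w, by rw [map_mul, map_natCast]; ring⟩

theorem WVal_ne_top : WVal p ≠ ⊤ := by
  intro h
  have hp : ((p : WField p))⁻¹ ∈ WVal p := h ▸ ValuationSubring.mem_top _
  obtain ⟨w, hw⟩ := mem_WVal.1 hp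
  have h0 : (p : WField p) ≠ 0 := Nat.cast_ne_zero.2 (Fact.out : p.Prime).ne_zero
  have h1 : w * (p : WRing p) = 1 := by
    apply algebraMap_WField_injective p
    rw [map_mul, hw, map_natCast, map_one, inv_mul_cancel₀ h0]
  exact mem_WIdeal_iff.1 (Ideal.mem_span_singleton_self (p : WRing p))
    (IsUnit.of_mul_eq_one_right w h1)

theorem charP_residueField_WVal : CharP (IsLocalRing.ResidueField (WVal p)) p := by
  refine ringChar.of_eq (CharP.ringChar_of_prime_eq_zero (Fact.out : p.Prime) ?_)
  rw [← map_natCast (IsLocalRing.residue (WVal p)), IsLocalRing.residue_eq_zero_iff,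
    ValuationSubring.valuation_lt_one_iff]
  exact WVal_valuation_lt_one_iff.2
    ⟨p, Ideal.mem_span_singleton_self _, by rw [map_natCast]; rfl⟩

theorem WFrob_algebraMap (w : WRing p) : WFrob p (algebraMap (WRing p) (WField p) w) =
    algebraMap (WRing p) (WField p)
      (WittVector.frobeniusEquiv p (AlgebraicClosure (ZMod p)) w) :=
  IsFractionRing.ringEquivOfRingEquiv_algebraMap _ _

theorem WVal_valuation_units (u : (WRing p)ˣ) :
    (WVal p).valuation (algebraMap (WRing p) (WField p) u) = 1 :=
  (WVal_valuation_algebraMap_le_one _).antisymm (not_lt.1 fun h =>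
    mem_WIdeal_iff.1 (WVal_valuation_algebraMap_lt_one_iff.1 h) u.isUnit)

/-- Every nonzero Witt vector is `p^n u` with `u` a unit; Frobenius fixes `p` and sends units to
units. -/
theorem WVal_valuation_WFrob (x : WField p) :
    (WVal p).valuation (WFrob p x) = (WVal p).valuation x := by
  have key : ∀ w : WRing p, (WVal p).valuation (WFrob p (algebraMap _ (WField p) w)) =
      (WVal p).valuation (algebraMap _ (WField p) w) := by
    intro w
    by_cases hw : w = 0
    · simp [hw]
    obtain ⟨n, u, rfl⟩ := WittVector.exists_eq_pow_p_mul' w hw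
    have hu := WVal_valuation_units
      (Units.map (WittVector.frobeniusEquiv p (AlgebraicClosure (ZMod p)) :
        WRing p →* WRing p) u)
    rw [map_mul, map_mul, map_mul, map_mul, map_pow, map_natCast, map_pow, map_natCast,
      WFrob_algebraMap, WVal_valuation_units]
    exact congrArg _ hu
  obtain ⟨a, b, _, rfl⟩ := IsFractionRing.div_surjective (A := WRing p) x
  rw [map_div₀, map_div₀, map_div₀, key, key]

theorem WVal_valuation_iterate_WFrob (n : ℕ) (x : WField p) :
    (WVal p).valuation ((WFrob p)^[n] x) = (WVal p).valuation x := by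
  induction n with
  | zero => rfl
  | succ n ih => rw [Function.iterate_succ_apply', WVal_valuation_WFrob, ih]

theorem WVal_valuation_iterate_WFrob_symm (n : ℕ) (x : WField p) :
    (WVal p).valuation ((WFrob p).symm^[n] x) = (WVal p).valuation x := by
  induction n with
  | zero => rfl
  | succ n ih =>
    rw [Function.iterate_succ_apply', ← ih, ← WVal_valuation_WFrob, RingEquiv.apply_symm_apply]

end WittValuation

/-! ### The analytic structure and the automorphism on the Witt field. -/

section WittStructure

variable {p : ℕ} [Fact p.Prime] {m n : ℕ}

/-- Points of the domain come from `W`, so each axiom on the analytic symbols is read off from the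
corresponding property of `Ann.eval`. -/
theorem inDomain_WVal_iff {x : Fin m → WField p} {y : Fin n → WField p} :
    InDomain (WVal p) x y ↔ ∃ (a : Fin m → WRing p) (b : Fin n → WRing p), (∀ j, b j ∈ WIdeal p) ∧
      (x = fun i => algebraMap (WRing p) (WField p) (a i)) ∧
      y = fun j => algebraMap (WRing p) (WField p) (b j) := by
  constructor
  · rintro ⟨hx, hy⟩
    choose a ha using fun i => mem_WVal.1 (hx i)
    choose b hb hb' using fun j => WVal_valuation_lt_one_iff.1 (hy j)
    exact ⟨a, b, hb, funext fun i => (ha i).symm, funext fun j => (hb' j).symm⟩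
  · rintro ⟨a, b, hb, rfl, rfl⟩
    exact ⟨fun i => ⟨a i, rfl⟩, fun j => WVal_valuation_algebraMap_lt_one_iff.2 (hb j)⟩

theorem WAnn_algebraMap (f : Ann (WRing p) (WIdeal p) m n) (a : Fin m → WRing p)
    {b : Fin n → WRing p} (hb : ∀ j, b j ∈ WIdeal p) :
    WAnn p m n f (fun i => algebraMap (WRing p) (WField p) (a i))
      (fun j => algebraMap (WRing p) (WField p) (b j)) =
      algebraMap (WRing p) (WField p) (Ann.eval f a b) := by
  rw [WAnn, if_pos (inDomain_WVal_iff.2 ⟨a, b, hb, rfl, rfl⟩)]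
  have h := Function.leftInverse_invFun (algebraMap_WField_injective p)
  simp only [h _]

theorem WAnn_of_not_inDomain (f : Ann (WRing p) (WIdeal p) m n) {x : Fin m → WField p}
    {y : Fin n → WField p} (h : ¬ InDomain (WVal p) x y) : WAnn p m n f x y = 0 :=
  if_neg h

theorem WAnn_mem (f : Ann (WRing p) (WIdeal p) m n) (x : Fin m → WField p)
    (y : Fin n → WField p) : WAnn p m n f x y ∈ WVal p := by
  rw [WAnn]
  split_ifs
  · exact ⟨_, rfl⟩
  · exact zero_mem _

theorem WAnn_one {x : Fin m → WField p} {y : Fin n → WField p} (h : InDomain (WVal p) x y) :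
    WAnn p m n 1 x y = 1 := by
  obtain ⟨a, b, hb, rfl, rfl⟩ := inDomain_WVal_iff.1 h
  rw [WAnn_algebraMap _ a hb, Ann.eval_one a hb, map_one]

theorem WAnn_add (f g : Ann (WRing p) (WIdeal p) m n) {x : Fin m → WField p}
    {y : Fin n → WField p} (h : InDomain (WVal p) x y) :
    WAnn p m n (f + g) x y = WAnn p m n f x y + WAnn p m n g x y := by
  obtain ⟨a, b, hb, rfl, rfl⟩ := inDomain_WVal_iff.1 h
  rw [WAnn_algebraMap _ a hb, WAnn_algebraMap _ a hb, WAnn_algebraMap _ a hb,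
    Ann.eval_add f g a hb, map_add]

theorem WAnn_mul (f g : Ann (WRing p) (WIdeal p) m n) {x : Fin m → WField p}
    {y : Fin n → WField p} (h : InDomain (WVal p) x y) :
    WAnn p m n (f * g) x y = WAnn p m n f x y * WAnn p m n g x y := by
  obtain ⟨a, b, hb, rfl, rfl⟩ := inDomain_WVal_iff.1 h
  rw [WAnn_algebraMap _ a hb, WAnn_algebraMap _ a hb, WAnn_algebraMap _ a hb,
    Ann.eval_mul f g a hb, map_mul]

theorem WAnn_incl {m' n' : ℕ} (hm : m ≤ m') (hn : n ≤ n') (f : Ann (WRing p) (WIdeal p) m n)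
    {x : Fin m' → WField p} {y : Fin n' → WField p} (h : InDomain (WVal p) x y) :
    WAnn p m' n' (Ann.incl (WRing p) (WIdeal p) hm hn f) x y =
      WAnn p m n f (fun i => x (Fin.castLE hm i)) (fun j => y (Fin.castLE hn j)) := by
  obtain ⟨a, b, hb, rfl, rfl⟩ := inDomain_WVal_iff.1 h
  rw [WAnn_algebraMap _ a hb, Ann.eval_incl hm hn f a hb,
    WAnn_algebraMap f (fun i => a (Fin.castLE hm i)) (b := fun j => b (Fin.castLE hn j))
      fun j => hb _]

theorem WAnn_const {a : WRing p} (ha : a ∈ WIdeal p) (x y : Fin 0 → WField p) :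
    (WVal p).valuation (WAnn p 0 0 (Ann.const (WRing p) (WIdeal p) a) x y) < 1 := by
  obtain ⟨a', b, hb, rfl, rfl⟩ := inDomain_WVal_iff.1
    (show InDomain (WVal p) x y from ⟨fun i => i.elim0, fun j => j.elim0⟩)
  rw [WAnn_algebraMap _ a' hb, Ann.eval_const]
  exact WVal_valuation_algebraMap_lt_one_iff.2 ha

theorem WAnn_X (i : Fin m) {x : Fin m → WField p} {y : Fin n → WField p}
    (h : InDomain (WVal p) x y) :
    WAnn p m n (Ann.X (WRing p) (WIdeal p) i) x y = x i := by
  obtain ⟨a, b, hb, rfl, rfl⟩ := inDomain_WVal_iff.1 h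
  rw [WAnn_algebraMap _ a hb, Ann.eval_X i a hb]

theorem WAnn_Y (j : Fin n) {x : Fin m → WField p} {y : Fin n → WField p}
    (h : InDomain (WVal p) x y) :
    WAnn p m n (Ann.Y (WRing p) (WIdeal p) j) x y = y j := by
  obtain ⟨a, b, hb, rfl, rfl⟩ := inDomain_WVal_iff.1 h
  rw [WAnn_algebraMap _ a hb, Ann.eval_Y j a hb]

theorem inDomain_congr {x x' : Fin m → WField p} {y y' : Fin n → WField p}
    (hx : ∀ i, (WVal p).valuation (x' i) = (WVal p).valuation (x i))
    (hy : ∀ j, (WVal p).valuation (y' j) = (WVal p).valuation (y j)) :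
    InDomain (WVal p) x' y' ↔ InDomain (WVal p) x y := by
  simp only [InDomain, ← ValuationSubring.valuation_le_one_iff, hx, hy]

theorem WFrob_WAnn (f : Ann (WRing p) (WIdeal p) m n) (x : Fin m → WField p)
    (y : Fin n → WField p) : WFrob p (WAnn p m n f x y) =
      WAnn p m n ((WAnnAut p).toEquiv m n f) (fun i => WFrob p (x i))
        (fun j => WFrob p (y j)) := by
  by_cases h : InDomain (WVal p) x y
  · have h' := (inDomain_congr (x' := fun i => WFrob p (x i)) (y' := fun j => WFrob p (y j))
      (fun i => WVal_valuation_WFrob (x i)) (fun j => WVal_valuation_WFrob (y j))).2 h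
    obtain ⟨a, b, hb, rfl, rfl⟩ := inDomain_WVal_iff.1 h
    simp only [WFrob_algebraMap] at h' ⊢
    have hb' : ∀ j, WittVector.frobeniusEquiv p (AlgebraicClosure (ZMod p)) (b j) ∈ WIdeal p :=
      fun j => WVal_valuation_algebraMap_lt_one_iff.1 (h'.2 j)
    rw [WAnn_algebraMap _ a hb, WAnn_algebraMap _ _ hb', WFrob_algebraMap]
    exact congrArg _ (Ann.map_eval _ _ f a hb)
  · rw [WAnn_of_not_inDomain _ h, map_zero, WAnn_of_not_inDomain]
    rwa [inDomain_congr (fun i => WVal_valuation_WFrob (x i))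
      (fun j => WVal_valuation_WFrob (y j))]

/-- The function defined by a unit is compatible with the leading term maps. -/
theorem mk_WAnn_unit (k : ℕ+) (E : (Ann (WRing p) (WIdeal p) m n)ˣ) {x x' : Fin m → WField p}
    {y y' : Fin n → WField p}
    (hx : ∀ i, LeadTerm.mk (WVal p) k (x' i) = LeadTerm.mk (WVal p) k (x i))
    (hy : ∀ j, LeadTerm.mk (WVal p) k (y' j) = LeadTerm.mk (WVal p) k (y j)) :
    LeadTerm.mk (WVal p) k (WAnn p m n E.1 x' y') = LeadTerm.mk (WVal p) k (WAnn p m n E.1 x y) := by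
  have hdom := inDomain_congr (fun i => LeadTerm.valuation_eq_of_mk_eq _ (hx i))
    (fun j => LeadTerm.valuation_eq_of_mk_eq _ (hy j))
  by_cases h : InDomain (WVal p) x y
  swap
  · rw [WAnn_of_not_inDomain _ h, WAnn_of_not_inDomain _ (hdom.not.2 h)]
  obtain ⟨a', b', hb', rfl, rfl⟩ := inDomain_WVal_iff.1 (hdom.2 h)
  obtain ⟨a, b, hb, rfl, rfl⟩ := inDomain_WVal_iff.1 h
  rw [WAnn_algebraMap _ a hb, WAnn_algebraMap _ a' hb']
  -- From `c' = c (1 + k w)` with `w ∈ pW` follows `c' - c = k c w`.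
  have hmem : ∀ {c c' : WRing p}, LeadTerm.mk (WVal p) k (algebraMap _ _ c') =
      LeadTerm.mk (WVal p) k (algebraMap _ _ c) →
      c' - c ∈ Ideal.span {((k : ℕ) : WRing p)} * WIdeal p := by
    intro c c' hc
    obtain ⟨μ, hμ, hcμ⟩ := LeadTerm.exists_of_mk_eq _ hc
    obtain ⟨w, hw, rfl⟩ := WVal_valuation_lt_one_iff.1 hμ
    have : c' - c = ((k : ℕ) : WRing p) * (c * w) := by
      apply algebraMap_WField_injective p
      rw [map_sub, hcμ, map_mul, map_mul, map_natCast]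
      ring
    rw [this]
    exact Ideal.mul_mem_mul (Ideal.mem_span_singleton_self _) (Ideal.mul_mem_left _ _ hw)
  -- The ideal `kpW` is open: if `k = p^r u` with `u` a unit, it contains `p^(r+1) W`.
  obtain ⟨r, hr⟩ : ∃ r, WIdeal p ^ r ≤ Ideal.span {((k : ℕ) : WRing p)} * WIdeal p := by
    have hk : ((k : ℕ) : WRing p) ≠ 0 := by
      intro h0
      have := congrArg (algebraMap (WRing p) (WField p)) h0
      rw [map_natCast, map_zero, Nat.cast_eq_zero] at this
      exact k.ne_zero this
    obtain ⟨r, u, hu⟩ := WittVector.exists_eq_pow_p_mul' _ hk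
    refine ⟨r + 1, ?_⟩
    rw [pow_succ]
    refine Ideal.mul_mono_left ?_
    rw [WIdeal, Ideal.span_singleton_pow, Ideal.span_singleton_le_span_singleton, hu]
    exact (u.isUnit.dvd_mul_right.1 (dvd_refl _) : _)
  have hsub := Ann.eval_sub_eval_mem E.1 hb' hb hr (fun i => hmem (hx i)) (fun j => hmem (hy j))
  obtain ⟨w, hw, hsub⟩ := Ideal.mem_span_singleton_mul.1 hsub
  -- As `E(a, b)` is invertible in `W`, the additive error `k w` equals `E(a, b) · k · (E⁻¹(a, b)
  -- w)`, a multiplicative change by an element of `1 + k 𝔪`.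
  have hunit : Ann.eval E.1 a b * Ann.eval (E⁻¹).1 a b = 1 := by
    rw [← Ann.eval_mul _ _ a hb, Units.mul_inv, Ann.eval_one a hb]
  rw [← LeadTerm.mk_mul_one_add (WVal p) k (algebraMap _ _ (Ann.eval E.1 a b))
    (WVal_valuation_algebraMap_lt_one_iff.2
      (Ideal.mul_mem_left _ (Ann.eval (E⁻¹).1 a b) hw))]
  congr 1
  rw [← map_natCast (algebraMap (WRing p) (WField p)), ← map_mul,
    ← map_one (algebraMap (WRing p) (WField p)), ← map_add, ← map_mul]
  congr 1
  linear_combination -hsub - (k : ℕ) * w * hunit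

variable (p)

theorem isAnalyticField_WStruc :
    @IsAnalyticField _ _ _ (WStruc p) (inferInstance : Field (WField p)) (WVal p) (WVal p) :=
  let _ : Field (WStruc p).K := (inferInstance : Field (WField p))
  { isValuedField_ofValuedField (WVal p) (WVal p) (WAnn p) (WFrob p) with
    quot_eq := fun _ _ hy => if_neg hy
    quot_zero := fun _ => if_pos rfl
    le := fun _ hx => hx
    rvDivR_rv := LeadTerm.valuation_rep_mk_le_iff (WVal p) 1
    ann_mem := fun f x y _ => WAnn_mem f x y
    ann_of_not := fun f _ _ h => WAnn_of_not_inDomain f h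
    ann_one := fun _ _ h => WAnn_one h
    ann_add := fun f g _ _ h => WAnn_add f g h
    ann_mul := fun f g _ _ h => WAnn_mul f g h
    ann_incl := fun hm hn f _ _ h => WAnn_incl hm hn f h
    ann_const := fun _ ha x y => WAnn_const ha x y
    ann_X := fun i _ _ h => WAnn_X i h
    ann_Y := fun j _ _ h => WAnn_Y j h
    unitRV_rv := fun k E _ _ => mk_WAnn_unit k E (fun _ => LeadTerm.mk_rep _)
      (fun _ => LeadTerm.mk_rep _) }

theorem WStruc_sigRV_bijective (n : ℕ+) : Function.Bijective ((WStruc p).sigRV n) := by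
  constructor
  · intro ξ η h
    rw [← LeadTerm.mk_rep ξ, ← LeadTerm.mk_rep η]
    exact (LeadTerm.mk_map_eq_iff (WVal p) (WFrob p) WVal_valuation_WFrob n _ _).1 h
  · intro ξ
    obtain ⟨x, rfl⟩ := LeadTerm.mk_surjective (WVal p) n ξ
    refine ⟨LeadTerm.mk (WVal p) n ((WFrob p).symm x), ?_⟩
    refine ((LeadTerm.mk_map_eq_iff (WVal p) (WFrob p) WVal_valuation_WFrob n _ _).2
      (LeadTerm.mk_rep (LeadTerm.mk (WVal p) n ((WFrob p).symm x)))).trans ?_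
    rw [RingEquiv.apply_symm_apply]

theorem WStruc_sigRV_mk (n : ℕ+) (x : WField p) :
    (WStruc p).sigRV n (LeadTerm.mk (WVal p) n x) = LeadTerm.mk (WVal p) n (WFrob p x) :=
  (LeadTerm.mk_map_eq_iff (WVal p) (WFrob p) WVal_valuation_WFrob n _ _).2 (LeadTerm.mk_rep _)

theorem WStruc_rvMap_mk (m n : ℕ+) (h : m ∣ n) (x : WField p) :
    (WStruc p).rvMap m n h (LeadTerm.mk (WVal p) n x) = LeadTerm.mk (WVal p) m x :=
  LeadTerm.mk_eq_of_dvd _ h (LeadTerm.mk_rep _)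

theorem WStruc_rvDivR_mk (x y : WField p) :
    (WStruc p).rvDivR (LeadTerm.mk (WVal p) 1 x) (LeadTerm.mk (WVal p) 1 y) ↔
      (WVal p).valuation y ≤ (WVal p).valuation x :=
  LeadTerm.valuation_rep_mk_le_iff (WVal p) 1 x y

theorem WStruc_sigRV_rvMap (m n : ℕ+) (h : m ∣ n) (ξ : LeadTerm (WVal p) n) :
    (WStruc p).sigRV m ((WStruc p).rvMap m n h ξ) =
      (WStruc p).rvMap m n h ((WStruc p).sigRV n ξ) := by
  obtain ⟨x, rfl⟩ := LeadTerm.mk_surjective (WVal p) n ξ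
  rw [WStruc_rvMap_mk, WStruc_sigRV_mk, WStruc_sigRV_mk, WStruc_rvMap_mk]

theorem WStruc_sigRV_rvDivR (ξ η : LeadTerm (WVal p) 1) :
    (WStruc p).rvDivR ((WStruc p).sigRV 1 ξ) ((WStruc p).sigRV 1 η) ↔ (WStruc p).rvDivR ξ η := by
  obtain ⟨x, rfl⟩ := LeadTerm.mk_surjective (WVal p) 1 ξ
  obtain ⟨y, rfl⟩ := LeadTerm.mk_surjective (WVal p) 1 η
  rw [WStruc_sigRV_mk, WStruc_sigRV_mk, WStruc_rvDivR_mk, WStruc_rvDivR_mk, WVal_valuation_WFrob,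
    WVal_valuation_WFrob]

theorem isAutomorphism_WStruc :
    @IsAutomorphism _ _ _ (WAnnAut p) (WStruc p) (inferInstance : Field (WField p)) (WFrob p) :=
  let _ : Field (WStruc p).K := (inferInstance : Field (WField p))
  { sig_eq := fun _ => rfl
    sigRV_bijective := WStruc_sigRV_bijective p
    sigRV_rv := WStruc_sigRV_mk p
    sigRV_rvMap := WStruc_sigRV_rvMap p
    sigRV_rvDivR := WStruc_sigRV_rvDivR p
    sig_ann := WFrob_WAnn }

end WittStructure

/-! ### Newton approximation and `σ`-Henselianity. -/

section SigmaHenselian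

/-- Over an algebraically closed field, an additive polynomial with a nonzero coefficient takes the
value `-1`. -/
theorem exists_one_add_sum_pow_eq_zero {k : Type*} [Field k] [IsAlgClosed k] {p N : ℕ}
    (hp : 1 < p) (c : Fin N → k) {i : Fin N} (hi : c i ≠ 0) :
    ∃ z : k, 1 + ∑ j, c j * z ^ p ^ (j : ℕ) = 0 := by
  let P : Polynomial k := 1 + ∑ j, Polynomial.C (c j) * Polynomial.X ^ p ^ (j : ℕ)
  have hcoeff : P.coeff (p ^ (i : ℕ)) = c i := by
    simp only [P, Polynomial.coeff_add, Polynomial.finsetSum_coeff, Polynomial.coeff_C_mul_X_pow]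
    -- The exponents `p ^ j` are distinct and positive, so no other `c j` and not the constant `1`
    -- contributes in degree `p ^ i`.
    rw [Finset.sum_eq_single i, if_pos rfl, Polynomial.coeff_one,
      if_neg (pow_ne_zero _ (by omega)), zero_add]
    · intro j _ hj
      rw [if_neg]
      intro h
      exact hj (Fin.ext (Nat.pow_right_injective hp h).symm)
    · simp
  have hdeg : P.degree ≠ 0 := by
    intro h
    apply hi
    rw [← hcoeff]
    refine Polynomial.coeff_eq_zero_of_degree_lt ?_
    rw [h]
    exact_mod_cast pow_pos (by omega) _
  obtain ⟨z, hz⟩ := IsAlgClosed.exists_root P hdeg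
  refine ⟨z, ?_⟩
  simpa [P, Polynomial.IsRoot, Polynomial.eval_finsetSum] using hz

variable {p : ℕ} [Fact p.Prime] {N : ℕ}

theorem constantCoeff_iterate_frobeniusEquiv (n : ℕ) (u : WRing p) :
    WittVector.constantCoeff
      ((WittVector.frobeniusEquiv p (AlgebraicClosure (ZMod p)))^[n] u) =
      WittVector.constantCoeff u ^ p ^ n :=
  WittVector.iterate_frobenius_coeff u n 0

/-- Modulo `p` the `j`-th iterate of Frobenius is `z ↦ z^(p^j)`, so a root over the residue field,
lifted by its Teichmüller representative, suffices. -/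
theorem exists_one_add_sum_frobenius_mem (c : Fin N → WRing p) {i : Fin N} (hi : IsUnit (c i)) :
    ∃ u, 1 + ∑ j, c j * (WittVector.frobeniusEquiv p (AlgebraicClosure (ZMod p)))^[(j : ℕ)] u ∈
      WIdeal p := by
  obtain ⟨z, hz⟩ := exists_one_add_sum_pow_eq_zero (Fact.out : p.Prime).one_lt
    (fun j => WittVector.constantCoeff (c j)) (hi.map WittVector.constantCoeff).ne_zero
  refine ⟨WittVector.teichmuller p z, ?_⟩
  rw [WIdeal, ← WittVector.ker_constantCoeff, RingHom.mem_ker, map_add, map_one, map_sum, ← hz]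
  congr 1
  refine Finset.sum_congr rfl fun j _ => ?_
  rw [map_mul, constantCoeff_iterate_frobeniusEquiv]
  exact congrArg (fun y => _ * y ^ _) (WittVector.teichmuller_coeff_zero p z)

theorem iterate_WFrob_algebraMap (n : ℕ) (w : WRing p) :
    (WFrob p)^[n] (algebraMap (WRing p) (WField p) w) = algebraMap (WRing p) (WField p)
      ((WittVector.frobeniusEquiv p (AlgebraicClosure (ZMod p)))^[n] w) := by
  induction n with
  | zero => rfl
  | succ n ih => rw [Function.iterate_succ_apply', Function.iterate_succ_apply', ih,
      WFrob_algebraMap]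

theorem iterate_WFrob_mul (n : ℕ) (x y : WField p) :
    (WFrob p)^[n] (x * y) = (WFrob p)^[n] x * (WFrob p)^[n] y :=
  iterate_map_mul (WFrob p) n x y

/-- One step of the approximation of a zero: a linear difference operator whose largest coefficient
is `d i` cancels the leading term of `-e` at an element of the form `(e / d i) u`. -/
theorem exists_valuation_add_sum_le (d : Fin N → WField p) {i : Fin N} (hi : d i ≠ 0)
    (hd : ∀ j, (WVal p).valuation (d j) ≤ (WVal p).valuation (d i)) (e : WField p) :
    ∃ u, (WVal p).valuation (e + ∑ j, d j *
        (WFrob p)^[(j : ℕ)] (e / d i * algebraMap (WRing p) (WField p) u)) ≤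
      (WVal p).valuation ((p : WField p) * e) := by
  by_cases he : e = 0
  · refine ⟨0, ?_⟩
    have h0 : ∀ n : ℕ, (WFrob p)^[n] 0 = 0 := fun n => iterate_map_zero (WFrob p) n
    simp [he, h0]
  have hle : ∀ j : Fin N, (WVal p).valuation (d j * (WFrob p)^[(j : ℕ)] (e / d i)) ≤
      (WVal p).valuation e := by
    intro j
    calc _ = (WVal p).valuation (d j) * (WVal p).valuation (e / d i) := by
          rw [map_mul, WVal_valuation_iterate_WFrob]
      _ ≤ (WVal p).valuation (d i) * (WVal p).valuation (e / d i) := mul_le_mul_left (hd j) _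
      _ = _ := by rw [← map_mul, mul_div_cancel₀ _ hi]
  -- Dividing by `e` normalises the operator: its coefficients become `c j ∈ W`, and `c i` is a unit
  -- because `σ` is an isometry, so `d i * σ^i (e / d i)` has the valuation of `e`.
  choose c hc using fun j => WVal_valuation_le_iff.1 (hle j)
  have hci : IsUnit (c i) := by
    by_contra h
    have h1 := WVal_valuation_algebraMap_lt_one_iff.2 (mem_WIdeal_iff.2 h)
    have h2 : (WVal p).valuation (algebraMap (WRing p) (WField p) (c i)) * (WVal p).valuation e =
        (WVal p).valuation e := by
      rw [← map_mul, hc, map_mul, WVal_valuation_iterate_WFrob, ← map_mul, mul_div_cancel₀ _ hi]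
    exact h1.ne (mul_eq_right₀ ((WVal p).valuation.ne_zero_iff.2 he) |>.1 h2)
  obtain ⟨u, hu⟩ := exists_one_add_sum_frobenius_mem c hci
  refine ⟨u, ?_⟩
  obtain ⟨w, hw⟩ := Ideal.mem_span_singleton'.1 hu
  rw [WVal_valuation_le_iff]
  refine ⟨w, ?_⟩
  have hsum : ∑ j, d j * (WFrob p)^[(j : ℕ)] (e / d i * algebraMap (WRing p) (WField p) u) =
      algebraMap (WRing p) (WField p) (∑ j, c j *
        (WittVector.frobeniusEquiv p (AlgebraicClosure (ZMod p)))^[(j : ℕ)] u) * e := by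
    rw [map_sum, Finset.sum_mul]
    refine Finset.sum_congr rfl fun j _ => ?_
    rw [iterate_WFrob_mul, ← mul_assoc, ← hc, iterate_WFrob_algebraMap, map_mul]
    ring
  have hw' := congrArg (algebraMap (WRing p) (WField p)) hw
  rw [map_mul, map_natCast, map_add, map_one] at hw'
  rw [hsum]
  linear_combination e * hw'

/-- The series `∑ pᵏ wₖ` converges in the ring of Witt vectors. -/
theorem exists_sum_pow_mul (w : ℕ → WRing p) :
    ∃ S : WRing p, ∀ n, ∃ r, S = ∑ k ∈ Finset.range n, (p : WRing p) ^ k * w k + p ^ n * r := by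
  obtain ⟨S, hS⟩ := IsPrecomplete.prec' (I := WIdeal p)
    (fun n => ∑ k ∈ Finset.range n, (p : WRing p) ^ k * w k) (by
      intro m n hmn
      rw [SModEq.sub_mem, ← neg_mem_iff, neg_sub, ← Finset.sum_range_add_sum_Ico _ hmn,
        add_sub_cancel_left, smul_eq_mul, Ideal.mul_top]
      refine sum_mem fun k hk => Ideal.mul_mem_right _ _ ?_
      exact Ideal.pow_le_pow_right (Finset.mem_Ico.1 hk).1
        (Ideal.pow_mem_pow (Ideal.mem_span_singleton_self _) k))
  refine ⟨S, fun n => ?_⟩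
  have h := (hS n).symm
  rw [SModEq.sub_mem, smul_eq_mul, Ideal.mul_top, WIdeal, Ideal.span_singleton_pow] at h
  obtain ⟨r, hr⟩ := Ideal.mem_span_singleton'.1 h
  exact ⟨r, by linear_combination -hr⟩

/-- The quotient `x / e` lies in every `p^n W`, and `W` is `p`-adically separated. -/
theorem eq_zero_of_valuation_le_pow_mul {x e : WField p}
    (h : ∀ n : ℕ, (WVal p).valuation x ≤ (WVal p).valuation ((p : WField p) ^ n * e)) : x = 0 := by
  by_cases he : e = 0
  · simpa [he] using h 0
  choose w hw using fun n => WVal_valuation_le_iff.1 (h n)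
  have hp : (p : WField p) ≠ 0 := Nat.cast_ne_zero.2 (Fact.out : p.Prime).ne_zero
  have h0 : w 0 = 0 := by
    refine IsHausdorff.haus (I := WIdeal p) inferInstance _ fun n => ?_
    rw [SModEq.zero, smul_eq_mul, Ideal.mul_top, WIdeal, Ideal.span_singleton_pow]
    refine Ideal.mem_span_singleton'.2 ⟨w n, algebraMap_WField_injective p ?_⟩
    have h1 := (hw n).trans (hw 0).symm
    refine mul_right_cancel₀ he ?_
    rw [map_mul, map_pow, map_natCast]
    linear_combination h1
  rw [← hw 0, h0, map_zero, zero_mul]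

/-- Newton approximation for functions that are approximated by a linear difference operator. -/
theorem exists_eq_zero_of_approx {F : WField p → WField p} {a g : WField p} {d : Fin N → WField p}
    (hF : ∀ x ∈ openBall (WVal p) a g, ∀ y ∈ openBall (WVal p) a g, x ≠ y → ∃ i : Fin N,
      (WVal p).valuation (F y - F x - ∑ j : Fin N, d j * (WFrob p)^[(j : ℕ)] (y - x)) <
        (WVal p).valuation (d i * (WFrob p)^[(i : ℕ)] (y - x)))
    (ha : ∃ i : Fin N, (WVal p).valuation (F a) <
      (WVal p).valuation (d i * (WFrob p)^[(i : ℕ)] g)) :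
    ∃ c, F c = 0 ∧ ∀ i, d i ≠ 0 →
      (WVal p).valuation (c - a) ≤ (WVal p).valuation (F a / d i) := by
  obtain ⟨i₁, hi₁⟩ := ha
  have : Nonempty (Fin N) := ⟨i₁⟩
  -- As `σ` preserves the valuation, a coefficient `D` of largest multiplicative valuation dominates
  -- every bound `d i * σ^i z` at once, whichever index the hypotheses provide.
  obtain ⟨i₀, hd⟩ := Finite.exists_max fun j => (WVal p).valuation (d j)
  set D := d i₀ with hD
  have hmul : ∀ (j : Fin N) (x : WField p),
      (WVal p).valuation (d j * (WFrob p)^[(j : ℕ)] x) ≤ (WVal p).valuation (D * x) := by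
    intro j x
    rw [map_mul, map_mul, WVal_valuation_iterate_WFrob]
    exact mul_le_mul_left (hd j) _
  have hag : (WVal p).valuation (F a) < (WVal p).valuation (D * g) := hi₁.trans_le (hmul i₁ g)
  have hD0 : D ≠ 0 := by
    intro h
    simp [h] at hag
  have hball : ∀ {x}, (WVal p).valuation (x - a) ≤ (WVal p).valuation (F a / D) →
      x ∈ openBall (WVal p) a g := by
    intro x hx
    refine lt_of_le_of_lt hx ?_
    rw [map_div₀, div_lt_iff₀ ((WVal p).valuation.pos_iff.2 hD0), ← map_mul, mul_comm]
    exact hag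
  -- Discreteness turns the strict inequality into a gain of a factor `p`; at `x = y` both sides are
  -- `0`.
  have happrox : ∀ x ∈ openBall (WVal p) a g, ∀ y ∈ openBall (WVal p) a g,
      (WVal p).valuation (F y - F x - ∑ j : Fin N, d j * (WFrob p)^[(j : ℕ)] (y - x)) ≤
        (WVal p).valuation ((p : WField p) * (D * (y - x))) := by
    intro x hx y hy
    by_cases hxy : x = y
    · have h0 : ∀ n : ℕ, (WFrob p)^[n] 0 = 0 := fun n => iterate_map_zero (WFrob p) n
      simp [hxy, h0]
    obtain ⟨i, hi⟩ := hF x hx y hy hxy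
    exact WVal_valuation_le_natCast_mul_of_lt (hi.trans_le (hmul i _))
  have hpmul : ∀ z : WField p,
      (WVal p).valuation ((p : WField p) * z) ≤ (WVal p).valuation z := fun z =>
    WVal_valuation_le_iff.2 ⟨p, by rw [map_natCast]⟩
  have hlip : ∀ x ∈ openBall (WVal p) a g, ∀ y ∈ openBall (WVal p) a g,
      (WVal p).valuation (F y - F x) ≤ (WVal p).valuation (D * (y - x)) := by
    intro x hx y hy
    rw [← sub_add_cancel (F y - F x) (∑ j : Fin N, d j * (WFrob p)^[(j : ℕ)] (y - x))]
    exact Valuation.map_add_le _ ((happrox x hx y hy).trans (hpmul _))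
      (Valuation.map_sum_le _ fun j _ => hmul j _)
  choose u hu using exists_valuation_add_sum_le d hD0 hd
  -- The correction cancels `F x` modulo `p F x` in the linearised equation.
  let step : WField p → WField p := fun x => F x / D * algebraMap (WRing p) (WField p) (u (F x))
  have hstep : ∀ x, (WVal p).valuation (step x) ≤ (WVal p).valuation (F x / D) := fun x =>
    WVal_valuation_le_iff.2 ⟨u (F x), mul_comm _ _⟩
  let x : ℕ → WField p := fun k => Nat.rec a (fun _ z => z + step z) k
  have hx_succ : ∀ k, x (k + 1) = x k + step (x k) := fun _ => rfl
  -- The bound on `x k - a` keeps the iterates in the ball where `F` is approximated; the bound on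
  -- `F (x k)` gains one factor `p` per step.
  have hinv : ∀ k, (WVal p).valuation (x k - a) ≤ (WVal p).valuation (F a / D) ∧
      (WVal p).valuation (F (x k)) ≤ (WVal p).valuation ((p : WField p) ^ k * F a) := by
    intro k
    induction k with
    | zero => simp [x]
    | succ k ih =>
      obtain ⟨ih₁, ih₂⟩ := ih
      have hpow : (WVal p).valuation ((p : WField p) ^ k * F a) ≤ (WVal p).valuation (F a) :=
        WVal_valuation_le_iff.2 ⟨p ^ k, by rw [map_pow, map_natCast]⟩
      have h1 : (WVal p).valuation (x (k + 1) - a) ≤ (WVal p).valuation (F a / D) := by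
        rw [hx_succ, add_sub_right_comm]
        refine Valuation.map_add_le _ ih₁ ((hstep _).trans ?_)
        rw [map_div₀, map_div₀]
        exact div_le_div_of_nonneg_right (ih₂.trans hpow) zero_le
      refine ⟨h1, ?_⟩
      have h2 := happrox _ (hball ih₁) _ (hball h1)
      have hdiff : x (k + 1) - x k = step (x k) := by rw [hx_succ, add_sub_cancel_left]
      rw [hdiff] at h2
      have h3 : F (x (k + 1)) = (F (x (k + 1)) - F (x k) -
          ∑ j : Fin N, d j * (WFrob p)^[(j : ℕ)] (step (x k))) +
          (F (x k) + ∑ j : Fin N, d j * (WFrob p)^[(j : ℕ)] (step (x k))) := by ring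
      have h4 : (WVal p).valuation ((p : WField p) * (D * step (x k))) ≤
          (WVal p).valuation ((p : WField p) * F (x k)) :=
        WVal_valuation_le_iff.2 ⟨u (F (x k)), by simp only [step]; field_simp⟩
      have h5 : (WVal p).valuation (F (x (k + 1))) ≤
          (WVal p).valuation ((p : WField p) * F (x k)) := by
        rw [h3]
        exact Valuation.map_add_le _ (h2.trans h4) (hu (F (x k)))
      refine h5.trans ?_
      rw [pow_succ', mul_assoc, map_mul, map_mul]
      exact mul_le_mul_right ih₂ _
  -- The `k`-th correction is `p^k (F a / D)` times an element of `W`, so the limit can be taken in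
  -- `W` itself.
  have hw : ∀ k, ∃ w, algebraMap (WRing p) (WField p) w * ((p : WField p) ^ k * (F a / D)) =
      step (x k) := by
    intro k
    refine WVal_valuation_le_iff.1 ((hstep _).trans ?_)
    rw [← mul_div_assoc, map_div₀, map_div₀]
    exact div_le_div_of_nonneg_right (hinv k).2 zero_le
  choose w hw using hw
  have hx : ∀ n, x n = a + F a / D *
      algebraMap (WRing p) (WField p) (∑ k ∈ Finset.range n, (p : WRing p) ^ k * w k) := by
    intro n
    induction n with
    | zero => simp [x]
    | succ n ih =>
      rw [hx_succ, ← hw, Finset.sum_range_succ, map_add, map_mul, map_pow, map_natCast]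
      linear_combination ih
  obtain ⟨S, hS⟩ := exists_sum_pow_mul w
  let c := a + F a / D * algebraMap (WRing p) (WField p) S
  have hc : (WVal p).valuation (c - a) ≤ (WVal p).valuation (F a / D) :=
    WVal_valuation_le_iff.2 ⟨S, by simp only [c]; ring⟩
  refine ⟨c, eq_zero_of_valuation_le_pow_mul (e := F a) fun n => ?_, fun i hi => hc.trans ?_⟩
  · obtain ⟨r, hr⟩ := hS n
    -- The tail of the series is `p^n (F a / D) r`. With the Lipschitz bound `hlip`, both `F c - F
    -- (x n)` and `F (x n)` are then multiples of `p^n F a`, for every `n`.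
    have h1 : (WVal p).valuation (D * (c - x n)) ≤
        (WVal p).valuation ((p : WField p) ^ n * F a) := by
      refine WVal_valuation_le_iff.2 ⟨r, ?_⟩
      simp only [c]
      rw [hx n, hr, map_add, map_mul, map_pow, map_natCast]
      field_simp
      ring
    rw [← sub_add_cancel (F c) (F (x n))]
    exact Valuation.map_add_le _ ((hlip _ (hball (hinv n).1) _ (hball hc)).trans h1) (hinv n).2
  -- Among the required bounds the strictest is the one for `D`, which `c` satisfies.
  · rw [map_div₀, map_div₀]
    exact div_le_div_of_nonneg_left zero_le ((WVal p).valuation.pos_iff.2 hi) (hd i)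

/-- The alternative `d = 0` is incompatible with the strict inequality at `a`, and `σ^(-i)` in the
bound does not change the valuation. -/
theorem exists_eq_zero_of_linearlyApproximates {f : (Fin N → WField p) → WField p}
    {a g : WField p} {d : Fin N → WField p}
    (hf : LinearlyApproximates (WVal p) (WFrob p) d f (openBall (WVal p) a g))
    (ha : ∃ i : Fin N, (WVal p).valuation (f (prol (WFrob p) N a)) <
      (WVal p).valuation (d i * (WFrob p)^[(i : ℕ)] g)) :
    ∃ c, f (prol (WFrob p) N c) = 0 ∧ ∀ i, d i ≠ 0 → (WVal p).valuation (c - a) ≤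
      (WVal p).valuation ((WFrob p).symm^[(i : ℕ)] (f (prol (WFrob p) N a) / d i)) := by
  have hd : d ≠ 0 := by
    rintro rfl
    simp at ha
  obtain ⟨c, hc, hca⟩ := exists_eq_zero_of_approx (F := fun x => f (prol (WFrob p) N x))
    (hf.resolve_right fun h => hd h.1) ha
  exact ⟨c, hc, fun i hi => (hca i hi).trans_eq (WVal_valuation_iterate_WFrob_symm _ _).symm⟩

variable (p)

theorem isSigmaHenselian_WStruc :
    @IsSigmaHenselian _ _ _ (WStruc p) (inferInstance : Field (WField p)) (WVal p) (WFrob p) :=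
  fun _ _ _ _ _ _ h => exists_eq_zero_of_linearlyApproximates h.1 h.2

end SigmaHenselian

end AnalyticDifference

theorem mainTheorem12 (p : ℕ) [Fact p.Prime] :
    AnalyticDifference.ModelsTAsH (AnalyticDifference.WAnnAut p) p
      (AnalyticDifference.WStruc p) :=
  ⟨(inferInstance : Field (AnalyticDifference.WField p)), AnalyticDifference.WVal p,
    AnalyticDifference.WVal p, AnalyticDifference.WFrob p,
    AnalyticDifference.isAnalyticField_WStruc p, AnalyticDifference.isAutomorphism_WStruc p,
    AnalyticDifference.isSigmaHenselian_WStruc p, AnalyticDifference.WVal_ne_top,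
    AnalyticDifference.charP_residueField_WVal⟩
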